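/- Let $\Gamma$ be a countable group with a left-invariant distance $d$ that is proper (every ball is finite), and write $|g|=d(g,e)$. Let $\mu$ be a symmetric probability measure on $\Gamma$ (i.e. $\mu(g^{-1})=\mu(g)$ for all $g$) with finite second moment, and put $M_2(\mu)=\bigl(\sum_g |g|^2\mu(g)\bigr)^{1/2}<\infty$. Let $\mu^{*n}$ be the $n$-fold convolution of $\mu$ (with $\mu^{*0}=\delta_e$), and $$h=\lim_n -\frac1n\sum_g \mu^{*n}(g)\log\mu^{*n}(g)\in[0,\infty],\qquad \rho=\limsup_n \sqrt[n]{\mu^{*n}(e)},\qquad \ell=\lim_n\frac1n\sum_g|g|\,\mu^{*n}(g).$$ For $-1<x<1$ let $A(x)=2x\,\mathrm{artanh}(x)+4\sqrt{1-x^2}-4$. Then $A\ge 0$ on $(-1,1)$, the limits defining $h$ and $\ell$ exist, $0\le \ell/M_2(\mu)<1$ (where $\ell/M_2(\mu)$ is read as $0$ if $M_2(\mu)=0$, i.e. $\mu=\delta_e$), and $$A\bigl(\ell/M_2(\mu)\bigr)+4(1-\rho)\le h .$$ In particular $4(1-\rho)\le h$ (Ledrappier's inequality). -/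

import Mathlib

open Filter Topology
open scoped ENNReal

noncomputable section

namespace RandomWalk

/-- The `n`-fold convolution `μ^{*n}`: the law of `X_n = γ_1 ⋯ γ_n` (with `X_0 = 1`), where the
`γ_i` are independent with law `μ`. -/
def convPow {Γ : Type*} [Group Γ] (μ : PMF Γ) : ℕ → PMF Γ
  | 0 => PMF.pure 1
  | n + 1 => (convPow μ n).bind fun x => μ.map fun g => x * g

/-- `μ` is symmetric: `μ(g⁻¹) = μ(g)`. -/
def IsSymmetric {Γ : Type*} [Group Γ] (μ : PMF Γ) : Prop :=
  ∀ g : Γ, μ g⁻¹ = μ g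

/-- The entropy `H(ν) = -∑ ν(g) log ν(g)`, in `[0, ∞]` (all terms are nonnegative). -/
def entropy {Γ : Type*} (ν : PMF Γ) : ℝ≥0∞ :=
  ∑' g, ENNReal.ofReal (-((ν g).toReal * Real.log (ν g).toReal))

/-- The mean distance to the identity `∑ |g| ν(g)`, in `[0, ∞]`. -/
def meanLength {Γ : Type*} [Group Γ] [MetricSpace Γ] (ν : PMF Γ) : ℝ≥0∞ :=
  ∑' g, edist g 1 * ν g

/-- `M₂(ν) = (∑ |g|² ν(g))^{1/2}`, in `[0, ∞]`. -/
def M₂ {Γ : Type*} [Group Γ] [MetricSpace Γ] (ν : PMF Γ) : ℝ≥0∞ :=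
  (∑' g, edist g 1 ^ 2 * ν g) ^ (1 / 2 : ℝ)

/-- The asymptotic entropy `h = lim H(μ^{*n}) / n`, in `[0, ∞]`. -/
def asymptoticEntropy {Γ : Type*} [Group Γ] (μ : PMF Γ) : ℝ≥0∞ :=
  limUnder atTop fun n : ℕ => entropy (convPow μ n) / n

/-- The drift `ℓ = lim (∑ |g| μ^{*n}(g)) / n`, in `[0, ∞]`. -/
def drift {Γ : Type*} [Group Γ] [MetricSpace Γ] (μ : PMF Γ) : ℝ≥0∞ :=
  limUnder atTop fun n : ℕ => meanLength (convPow μ n) / n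

/-- The spectral radius `ρ = limsup μ^{*n}(1)^{1/n}`. -/
def spectralRadius {Γ : Type*} [Group Γ] (μ : PMF Γ) : ℝ :=
  limsup (fun n : ℕ => (convPow μ n 1).toReal ^ (1 / n : ℝ)) atTop

/-- `A(x) = 2 x artanh x + 4 √(1 - x²) - 4`, for `-1 < x < 1`. -/
def A (x : ℝ) : ℝ :=
  2 * x * Real.artanh x + 4 * √(1 - x ^ 2) - 4

end RandomWalk

end


/-!
Run the walk up to an independent geometric time of parameter `ε`, and let `q` be the law of its
position. For the step from `x` to `y = g⁻¹ x`, let `X = (q y - q x) / (q x + q y)` and give it the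
mass `μ g * (q x + q y) / 2`. Since `q` is `ε δ₁ + (1 - ε) μ * q` and `μ` is symmetric, summing by
parts against a function `F` gives
`∑ μ g * (F x - F y) * (q y - q x) / 2 = ε / (1 - ε) * (∑ F q - F 1)`.

* For `F = -log q` the right-hand side is at most `ε / (1 - ε) * H(q)`, and the identity
  `2 * X * artanh X = X * (log (q y) - log (q x))` turns the left-hand side into the mean of `A X`
  plus `4 - 4 ⟪√q, P √q⟫`, where `P` is the Markov operator. As `P` has norm at most `ρ`, the mean
  of `A X` is at most `ε / (1 - ε) * H(q) - 4 * (1 - ρ)`.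
* For `F = |·|` the right-hand side is at least `ℓ`, and the left-hand side is at most
  `M₂ * (mean of X²) ^ (1 / 2)`, because `||x| - |y|| ≤ |g|`.

Since `A X` is a convex nondecreasing function of `X²`, Jensen's inequality gives
`A (ℓ / M₂) + 4 * (1 - ρ) ≤ ε / (1 - ε) * H(q)`, and the right-hand side is asymptotically at most
`h` as `ε → 0`, because `H(μ^{*n}) ≤ C + n * s` for every `s > h`.
-/
noncomputable section

namespace RandomWalk

/-! ### The function `A` -/

/-- The even function `artanh x / x`, extended by `1` at `x = 0`, on `(-1, 1)`. It is defined by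
its power series, which shows that it increases with `|x|`. -/
def artanhRatio (x : ℝ) : ℝ :=
  ∑' k : ℕ, x ^ (2 * k) / (2 * k + 1)

lemma summable_artanhRatio {x : ℝ} (hx : x ∈ Set.Ioo (-1 : ℝ) 1) :
    Summable fun k : ℕ => x ^ (2 * k) / (2 * k + 1 : ℝ) := by
  have hx2 : x ^ 2 < 1 := by nlinarith [hx.1, hx.2]
  refine .of_nonneg_of_le (fun k => ?_) (fun k => ?_)
    (summable_geometric_of_lt_one (sq_nonneg x) hx2)
  · rw [pow_mul]
    positivity
  · rw [pow_mul]
    exact div_le_self (by positivity) (by linarith [k.cast_nonneg (α := ℝ)])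

lemma artanhRatio_zero : artanhRatio 0 = 1 := by
  rw [artanhRatio, tsum_eq_single 0 fun k hk => by simp [hk]]
  simp

lemma artanhRatio_le_artanhRatio {x y : ℝ} (hx : 0 ≤ x) (hxy : x ≤ y) (hy : y < 1) :
    artanhRatio x ≤ artanhRatio y :=
  (summable_artanhRatio ⟨by linarith, by linarith⟩).tsum_le_tsum
    (fun k => by gcongr) (summable_artanhRatio ⟨by linarith, hy⟩)

lemma mul_artanhRatio {x : ℝ} (hx : x ∈ Set.Ioo (-1 : ℝ) 1) :
    x * artanhRatio x = Real.artanh x := by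
  have hlog : 2 * Real.artanh x = Real.log (1 + x) - Real.log (1 - x) := by
    rw [Real.artanh_eq_half_log ⟨hx.1.le, hx.2.le⟩,
      Real.log_div (by linarith [hx.1]) (by linarith [hx.2])]
    ring
  have hseries : 2 * (x * artanhRatio x) = Real.log (1 + x) - Real.log (1 - x) := by
    rw [← (Real.hasSum_log_sub_log_of_abs_lt_one (abs_lt.2 hx)).tsum_eq, artanhRatio,
      ← tsum_mul_left, ← tsum_mul_left]
    exact tsum_congr fun k => by ring
  linarith

lemma hasDerivAt_artanh {x : ℝ} (hx : x ∈ Set.Ioo (-1 : ℝ) 1) :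
    HasDerivAt Real.artanh (1 / (1 - x ^ 2)) x := by
  have hpos : 0 < 1 + x := by linarith [hx.1]
  have hneg : 0 < 1 - x := by linarith [hx.2]
  have hquot : HasDerivAt (fun y : ℝ => (1 + y) / (1 - y)) (2 / (1 - x) ^ 2) x := by
    refine HasDerivAt.congr_deriv
      (((hasDerivAt_id x).const_add 1).div ((hasDerivAt_id x).const_sub 1) hneg.ne') ?_
    simp only [id]
    ring
  refine (((hquot.log (by positivity)).const_mul (1 / 2)).congr_of_eventuallyEq ?_).congr_deriv ?_
  · filter_upwards [Ioo_mem_nhds hx.1 hx.2] with y hy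
    exact Real.artanh_eq_half_log ⟨hy.1.le, hy.2.le⟩
  · rw [show 1 - x ^ 2 = (1 + x) * (1 - x) by ring]
    field_simp

lemma A_zero : A 0 = 0 := by
  simp [A]

lemma A_neg (x : ℝ) : A (-x) = A x := by
  have hodd : Real.artanh (-x) = -Real.artanh x := by
    rw [Real.artanh, Real.artanh, sub_neg_eq_add, ← sub_eq_add_neg, ← inv_div, Real.sqrt_inv,
      Real.log_inv]
  rw [A, A, hodd, neg_sq]
  ring

/-- The derivative of `A` with respect to `x ^ 2`, that is, `A' x / (2 * x)`, extended by `0` at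
`x = 0`. It increases with `|x|`, which means that `A` is a convex function of `x ^ 2`. -/
def slopeA (x : ℝ) : ℝ :=
  (1 / √(1 - x ^ 2) - 1) ^ 2 + (artanhRatio x - 1)

lemma slopeA_le_slopeA {x y : ℝ} (hx : 0 ≤ x) (hxy : x ≤ y) (hy : y < 1) :
    slopeA x ≤ slopeA y := by
  have hsqrt_pos : 0 < √(1 - y ^ 2) := Real.sqrt_pos.2 (by nlinarith)
  have hsqrt_anti : √(1 - y ^ 2) ≤ √(1 - x ^ 2) := Real.sqrt_le_sqrt (by nlinarith)
  have hone : 1 ≤ 1 / √(1 - x ^ 2) :=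
    one_le_one_div (hsqrt_pos.trans_le hsqrt_anti) (Real.sqrt_le_one.2 (by nlinarith))
  have hmono : 1 / √(1 - x ^ 2) ≤ 1 / √(1 - y ^ 2) :=
    one_div_le_one_div_of_le hsqrt_pos hsqrt_anti
  exact add_le_add (pow_le_pow_left₀ (sub_nonneg.2 hone) (sub_le_sub_right hmono 1) 2)
    (sub_le_sub_right (artanhRatio_le_artanhRatio hx hxy hy) 1)

lemma slopeA_zero : slopeA 0 = 0 := by
  simp [slopeA, artanhRatio_zero]

lemma slopeA_nonneg {x : ℝ} (hx : 0 ≤ x) (hx1 : x < 1) : 0 ≤ slopeA x :=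
  slopeA_zero ▸ slopeA_le_slopeA le_rfl hx hx1

lemma hasDerivAt_A {x : ℝ} (hx : x ∈ Set.Ioo (-1 : ℝ) 1) :
    HasDerivAt A (2 * x * slopeA x) x := by
  have hpos : 0 < 1 - x ^ 2 := by nlinarith [hx.1, hx.2]
  have hsqrt : HasDerivAt (fun y : ℝ => √(1 - y ^ 2)) (-(2 * x) / (2 * √(1 - x ^ 2))) x := by
    simpa using ((hasDerivAt_pow 2 x).const_sub 1).sqrt hpos.ne'
  refine (((((hasDerivAt_id x).const_mul 2).mul (hasDerivAt_artanh hx)).add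
    (hsqrt.const_mul 4)).sub_const 4).congr_deriv ?_
  have hsqrt_ne : √(1 - x ^ 2) ≠ 0 := (Real.sqrt_pos.2 hpos).ne'
  have hinv_sq : (1 / √(1 - x ^ 2)) ^ 2 = 1 / (1 - x ^ 2) := by
    rw [div_pow, Real.sq_sqrt hpos.le, one_pow]
  have hcancel : -(2 * x) / (2 * √(1 - x ^ 2)) = -x * (1 / √(1 - x ^ 2)) := by
    field_simp
  rw [slopeA, ← mul_artanhRatio hx, ← hinv_sq, hcancel, id]
  ring

lemma A_add_slopeA_mul_le {x₀ x : ℝ} (h₀ : 0 ≤ x₀) (h₁ : x₀ < 1) (hx : x ∈ Set.Ioo (-1 : ℝ) 1) :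
    A x₀ + slopeA x₀ * (x ^ 2 - x₀ ^ 2) ≤ A x := by
  wlog hx0 : 0 ≤ x generalizing x
  · simpa only [A_neg, neg_sq] using
      this (x := -x) ⟨by linarith [hx.2], by linarith [hx.1]⟩ (by linarith)
  let f : ℝ → ℝ := fun y => A y - slopeA x₀ * y ^ 2
  have hderiv : ∀ z ∈ Set.Ico (0 : ℝ) 1, HasDerivAt f (2 * z * (slopeA z - slopeA x₀)) z := by
    intro z hz
    refine ((hasDerivAt_A ⟨by linarith [hz.1], hz.2⟩).sub
      ((hasDerivAt_pow 2 z).const_mul (slopeA x₀))).congr_deriv ?_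
    norm_num
    ring
  have hanti : AntitoneOn f (Set.Icc 0 x₀) := by
    refine antitoneOn_of_hasDerivWithinAt_nonpos (convex_Icc 0 x₀)
      (fun z hz => (hderiv z ⟨hz.1, by linarith [hz.2]⟩).continuousAt.continuousWithinAt)
      (fun z hz => (hderiv z ?_).hasDerivWithinAt) fun z hz => ?_ <;> rw [interior_Icc] at hz
    · exact ⟨hz.1.le, hz.2.trans h₁⟩
    · exact mul_nonpos_of_nonneg_of_nonpos (by linarith [hz.1])
        (sub_nonpos.2 (slopeA_le_slopeA hz.1.le hz.2.le h₁))
  have hmono : MonotoneOn f (Set.Ico x₀ 1) := by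
    refine monotoneOn_of_hasDerivWithinAt_nonneg (convex_Ico x₀ 1)
      (fun z hz => (hderiv z ⟨h₀.trans hz.1, hz.2⟩).continuousAt.continuousWithinAt)
      (fun z hz => (hderiv z ?_).hasDerivWithinAt) fun z hz => ?_ <;> rw [interior_Ico] at hz
    · exact ⟨h₀.trans hz.1.le, hz.2⟩
    · exact mul_nonneg (by linarith [hz.1]) (sub_nonneg.2 (slopeA_le_slopeA h₀ hz.1.le hz.2))
  have hmin : f x₀ ≤ f x := by
    rcases le_total x x₀ with h | h
    · exact hanti ⟨hx0, h⟩ ⟨h₀, le_rfl⟩ h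
    · exact hmono ⟨le_rfl, h₁⟩ ⟨h, hx.2⟩ h
  simp only [f] at hmin
  linarith

lemma A_nonneg {x : ℝ} (hx : x ∈ Set.Ioo (-1 : ℝ) 1) : 0 ≤ A x := by
  simpa [A_zero, slopeA_zero] using A_add_slopeA_mul_le le_rfl one_pos hx

/-- Jensen's inequality for `A`, as a function of `x ^ 2`. -/
lemma A_le_of_hasSum {ι : Type*} {w X : ι → ℝ} {x₀ a v : ℝ} (hw : ∀ i, 0 ≤ w i) (hw1 : HasSum w 1)
    (hX : ∀ i, w i ≠ 0 → X i ∈ Set.Ioo (-1 : ℝ) 1) (ha : HasSum (fun i => w i * A (X i)) a)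
    (hv : HasSum (fun i => w i * X i ^ 2) v) (h₀ : 0 ≤ x₀) (h₁ : x₀ < 1) (hx₀ : x₀ ^ 2 ≤ v) :
    A x₀ ≤ a := by
  have htangent : ∀ i, (A x₀ - slopeA x₀ * x₀ ^ 2) * w i + slopeA x₀ * (w i * X i ^ 2) ≤
      w i * A (X i) := by
    intro i
    rcases eq_or_ne (w i) 0 with h | h
    · simp [h]
    · linarith [mul_le_mul_of_nonneg_left (A_add_slopeA_mul_le h₀ h₁ (hX i h)) (hw i)]
  have hsum := hasSum_le htangent ((hw1.mul_left _).add (hv.mul_left _)) ha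
  linarith [mul_le_mul_of_nonneg_left hx₀ (slopeA_nonneg h₀ h₁)]

/-! ### The relative increment along an edge -/

section RelIncrement

variable {a b : ℝ}

/-- The relative increment of a mass passing from `a` to `b`. The junk value `0` at `a = b = 0` is
harmless, since it is always weighted by `a + b`. -/
def relIncrement (a b : ℝ) : ℝ :=
  (b - a) / (a + b)

lemma abs_relIncrement_le_one (ha : 0 ≤ a) (hb : 0 ≤ b) : |relIncrement a b| ≤ 1 := by
  rw [relIncrement, abs_div, abs_of_nonneg (add_nonneg ha hb)]
  exact div_le_one_of_le₀ (abs_le.2 ⟨by linarith, by linarith⟩) (add_nonneg ha hb)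

lemma add_mul_relIncrement (ha : 0 ≤ a) (hb : 0 ≤ b) : (a + b) * relIncrement a b = b - a := by
  rcases (add_nonneg ha hb).eq_or_lt with h | h
  · obtain ⟨rfl, rfl⟩ : a = 0 ∧ b = 0 := ⟨by linarith, by linarith⟩
    simp
  · rw [relIncrement, mul_div_cancel₀ _ h.ne']

lemma relIncrement_mem_Ioo (ha : 0 < a) (hb : 0 < b) : relIncrement a b ∈ Set.Ioo (-1 : ℝ) 1 := by
  have hs : 0 < a + b := by positivity
  rw [relIncrement, Set.mem_Ioo, lt_div_iff₀ hs, div_lt_one hs]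
  constructor <;> linarith

lemma artanh_relIncrement (ha : 0 < a) (hb : 0 < b) :
    Real.artanh (relIncrement a b) = (Real.log b - Real.log a) / 2 := by
  have hX := relIncrement_mem_Ioo ha hb
  have hratio : (1 + relIncrement a b) / (1 - relIncrement a b) = b / a := by
    rw [div_eq_div_iff (by linarith [hX.2]) ha.ne', relIncrement]
    field_simp
    ring
  rw [Real.artanh_eq_half_log ⟨hX.1.le, hX.2.le⟩, hratio, Real.log_div hb.ne' ha.ne']
  ring

lemma sqrt_one_sub_relIncrement_sq (ha : 0 < a) (hb : 0 < b) :
    √(1 - relIncrement a b ^ 2) = 2 * (√a * √b) / (a + b) := by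
  rw [Real.sqrt_eq_iff_mul_self_eq_of_pos (by positivity), ← sq, div_pow, mul_pow, mul_pow,
    Real.sq_sqrt ha.le, Real.sq_sqrt hb.le, relIncrement]
  field_simp
  ring

/-- The right-hand side collects the contributions of an edge to the entropy production, to the
quadratic form of the walk at the square roots of the masses, and to the total mass. -/
lemma add_div_two_mul_A_relIncrement (ha : 0 ≤ a) (hb : 0 ≤ b) (hab : a = 0 ↔ b = 0) :
    (a + b) / 2 * A (relIncrement a b) =
      (b - a) * (Real.log b - Real.log a) / 2 + 4 * (√a * √b) - 4 * ((a + b) / 2) := by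
  rcases ha.eq_or_lt with rfl | ha
  · simp [hab.1 rfl]
  have hb : 0 < b := hb.lt_of_ne fun h => ha.ne' (hab.2 h.symm)
  rw [A, artanh_relIncrement ha hb, sqrt_one_sub_relIncrement_sq ha hb, relIncrement]
  field_simp

end RelIncrement

/-! ### Sums and subadditive sequences in `[0, ∞]` -/

lemma tsum_mul_tsum {ι κ : Type*} (f : ι → ℝ≥0∞) (g : κ → ℝ≥0∞) :
    (∑' i, f i) * ∑' j, g j = ∑' i, ∑' j, f i * g j := by
  simp_rw [ENNReal.tsum_mul_left, ENNReal.tsum_mul_right]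

lemma four_mul_mul_le_add_sq (a b : ℝ≥0∞) : 4 * (a * b) ≤ (a + b) ^ 2 := by
  wlog hab : a ≤ b generalizing a b
  · rw [mul_comm a, add_comm a]
    exact this b a (le_of_not_ge hab)
  obtain ⟨c, rfl⟩ := exists_add_of_le hab
  calc 4 * (a * (a + c)) ≤ 4 * (a * (a + c)) + c ^ 2 := le_self_add
    _ = (a + (a + c)) ^ 2 := by ring

lemma tsum_sq_le_tsum_mul_tsum_of_sq_le_mul {ι : Type*} {r f g : ι → ℝ≥0∞}
    (h : ∀ i, r i ^ 2 ≤ f i * g i) : (∑' i, r i) ^ 2 ≤ (∑' i, f i) * ∑' i, g i := by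
  have h_cross (i j) : 2 * (r i * r j) ≤ f i * g j + f j * g i := by
    refine (ENNReal.pow_le_pow_left_iff two_ne_zero).1 ?_
    calc (2 * (r i * r j)) ^ 2 = 4 * (r i ^ 2 * r j ^ 2) := by ring
      _ ≤ 4 * (f i * g i * (f j * g j)) := by gcongr <;> exact h _
      _ = 4 * (f i * g j * (f j * g i)) := by ring
      _ ≤ (f i * g j + f j * g i) ^ 2 := four_mul_mul_le_add_sq _ _
  refine (ENNReal.mul_le_mul_iff_right two_ne_zero ENNReal.ofNat_ne_top).1 ?_
  calc 2 * (∑' i, r i) ^ 2 = ∑' i, ∑' j, 2 * (r i * r j) := by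
        simp_rw [sq, tsum_mul_tsum, ENNReal.tsum_mul_left]
    _ ≤ ∑' i, ∑' j, (f i * g j + f j * g i) :=
        ENNReal.tsum_le_tsum fun i => ENNReal.tsum_le_tsum (h_cross i)
    _ = 2 * ((∑' i, f i) * ∑' i, g i) := by
        simp_rw [ENNReal.tsum_add]
        rw [ENNReal.tsum_comm (f := fun i j => f j * g i), ← tsum_mul_tsum, two_mul]

lemma le_mul_of_subadditive {u : ℕ → ℝ≥0∞} (h0 : u 0 = 0) (hu : ∀ m n, u (m + n) ≤ u m + u n)
    (n : ℕ) : u n ≤ n * u 1 := by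
  induction n with
  | zero => simp [h0]
  | succ n ih =>
    calc u (n + 1) ≤ u n + u 1 := hu n 1
      _ ≤ n * u 1 + u 1 := by gcongr
      _ = (n + 1 : ℕ) * u 1 := by push_cast; ring

/-- Fekete's lemma in `[0, ∞]`. -/
lemma exists_tendsto_div_of_subadditive {u : ℕ → ℝ≥0∞} (hu : ∀ m n, u (m + n) ≤ u m + u n)
    (htop : ∀ n, u n ≠ ∞) :
    ∃ L, Tendsto (fun n => u n / n) atTop (𝓝 L) ∧ ∀ n : ℕ, n * L ≤ u n := by
  have hsub : Subadditive fun n => (u n).toReal := fun m n =>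
    (ENNReal.toReal_mono (ENNReal.add_ne_top.2 ⟨htop m, htop n⟩) (hu m n)).trans
      ENNReal.toReal_add_le
  have hbdd : BddBelow (Set.range fun n : ℕ => (u n).toReal / n) :=
    ⟨0, by rintro _ ⟨n, rfl⟩; positivity⟩
  have hdiv {n : ℕ} (hn : 0 < n) : ENNReal.ofReal ((u n).toReal / n) = u n / n := by
    rw [ENNReal.ofReal_div_of_pos (Nat.cast_pos.2 hn), ENNReal.ofReal_toReal (htop n),
      ENNReal.ofReal_natCast]
  refine ⟨ENNReal.ofReal hsub.lim, ?_, fun n => ?_⟩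
  · refine (ENNReal.tendsto_ofReal (hsub.tendsto_lim hbdd)).congr' ?_
    filter_upwards [eventually_gt_atTop 0] with n hn using hdiv hn
  · rcases Nat.eq_zero_or_pos n with rfl | hn
    · simp
    · refine mul_comm (n : ℝ≥0∞) _ ▸ ENNReal.mul_le_of_le_div ?_
      exact hdiv hn ▸ ENNReal.ofReal_le_ofReal (hsub.lim_le_div hbdd hn.ne')

lemma le_of_frequently_pow_le_mul_pow {a r C : ℝ≥0∞} (hC : C ≠ ∞)
    (h : ∃ᶠ n in atTop, a ^ n ≤ C * r ^ n) : a ≤ r := by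
  by_contra! hlt
  have h_tendsto : Tendsto (fun n => (a / r) ^ n) atTop (𝓝 ∞) :=
    ENNReal.tendsto_pow_atTop_nhds_top_iff.2 <|
      (ENNReal.lt_div_iff_mul_lt (.inr ENNReal.one_ne_top) (.inl hlt.ne_top)).2 (by rwa [one_mul])
  obtain ⟨n, hn, hCn⟩ := (h.and_eventually (h_tendsto.eventually (lt_mem_nhds hC.lt_top))).exists
  rw [div_eq_mul_inv, mul_pow, ← ENNReal.inv_pow, ← div_eq_mul_inv] at hCn
  exact hCn.not_ge (ENNReal.div_le_of_le_mul hn)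

/-! ### Entropy of mixtures -/

lemma tsum_ite_zero_apply {α : Type*} [DecidableEq α] (ν : PMF α) (a : α) :
    ∑' b, (if b = a then 0 else ν b) = 1 - ν a := by
  refine ENNReal.eq_sub_of_add_eq (ν.apply_ne_top a) ?_
  rw [add_comm]
  convert! (ENNReal.tsum_eq_add_tsum_ite a).symm.trans ν.tsum_coe

lemma tsum_mul_bind {α β : Type*} (p : PMF α) (κ : α → PMF β) (f : β → ℝ≥0∞) :
    ∑' b, f b * p.bind κ b = ∑' a, p a * ∑' b, f b * κ a b := by
  simp_rw [PMF.bind_apply, ← ENNReal.tsum_mul_left]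
  rw [ENNReal.tsum_comm]
  exact tsum_congr fun a => tsum_congr fun b => mul_left_comm _ _ _

/-- The information content `-log a` of an event of probability `a`, as an element of `[0, ∞]`.
With `Real.log 0 = 0`, it vanishes at `a = 0`. -/
def info (a : ℝ≥0∞) : ℝ≥0∞ :=
  ENNReal.ofReal (-Real.log a.toReal)

lemma entropy_eq_tsum_info {α : Type*} (ν : PMF α) : entropy ν = ∑' x, info (ν x) * ν x := by
  refine tsum_congr fun x => ?_
  rw [← mul_neg, ENNReal.ofReal_mul ENNReal.toReal_nonneg, ENNReal.ofReal_toReal (ν.apply_ne_top x),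
    mul_comm, info]

lemma info_anti {a b : ℝ≥0∞} (ha : a ≠ 0) (hab : a ≤ b) (hb : b ≠ ∞) : info b ≤ info a := by
  have ha_pos : 0 < a.toReal := ENNReal.toReal_pos ha (ne_top_of_le_ne_top hb hab)
  have hab_real : a.toReal ≤ b.toReal := ENNReal.toReal_mono hb hab
  unfold info
  gcongr

lemma info_mul_le {a b : ℝ≥0∞} (ha : a ≠ 0) (hb : b ≠ 0) (ha' : a ≠ ∞) (hb' : b ≠ ∞) :
    info (a * b) ≤ info a + info b := by
  rw [info, ENNReal.toReal_mul, Real.log_mul (ENNReal.toReal_pos ha ha').ne'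
    (ENNReal.toReal_pos hb hb').ne', neg_add]
  exact ENNReal.ofReal_add_le

lemma info_mul_add_eq_ofReal {a b c : ℝ≥0∞} (ha : a ≤ 1) (hb : b ≠ ∞) (hc : c ≠ ∞) :
    info a * b + c = ENNReal.ofReal (-Real.log a.toReal * b.toReal + c.toReal) := by
  have hlog : 0 ≤ -Real.log a.toReal :=
    neg_nonneg.2 (Real.log_nonpos ENNReal.toReal_nonneg (ENNReal.toReal_le_of_le_ofReal one_pos.le
      (by simpa using ha)))
  rw [ENNReal.ofReal_add (mul_nonneg hlog ENNReal.toReal_nonneg) ENNReal.toReal_nonneg,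
    ENNReal.ofReal_mul hlog, ENNReal.ofReal_toReal hb, ENNReal.ofReal_toReal hc, info]

lemma info_mul_add_le_info_mul_add {a b : ℝ≥0∞} (ha : a ≤ 1) (hb : b ≠ 0) (hb' : b ≤ 1) :
    info a * a + a ≤ info b * a + b := by
  rcases eq_or_ne a 0 with rfl | ha0
  · simp
  have ha_top : a ≠ ∞ := ne_top_of_le_ne_top ENNReal.one_ne_top ha
  have hb_top : b ≠ ∞ := ne_top_of_le_ne_top ENNReal.one_ne_top hb'
  rw [info_mul_add_eq_ofReal ha ha_top ha_top, info_mul_add_eq_ofReal hb' ha_top hb_top]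
  refine ENNReal.ofReal_le_ofReal ?_
  have hx : 0 < a.toReal := ENNReal.toReal_pos ha0 ha_top
  have hy : 0 < b.toReal := ENNReal.toReal_pos hb hb_top
  have hlog : Real.log b.toReal - Real.log a.toReal ≤ b.toReal / a.toReal - 1 := by
    rw [← Real.log_div hy.ne' hx.ne']
    exact Real.log_le_sub_one_of_pos (by positivity)
  have := mul_le_mul_of_nonneg_right hlog hx.le
  rw [sub_mul, sub_mul, div_mul_cancel₀ _ hx.ne'] at this
  linarith

lemma entropy_bind_le {α β : Type*} (p : PMF α) (κ : α → PMF β) :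
    entropy (p.bind κ) ≤ entropy p + ∑' a, p a * entropy (κ a) := by
  have h_info (a b) :
      p a * (info (p.bind κ b) * κ a b) ≤ p a * (info (p a) * κ a b + info (κ a b) * κ a b) := by
    rcases eq_or_ne (p a) 0 with ha | ha
    · simp [ha]
    rcases eq_or_ne (κ a b) 0 with hb | hb
    · simp [hb]
    have hle : p a * κ a b ≤ p.bind κ b := by
      rw [PMF.bind_apply]
      exact ENNReal.le_tsum a
    rw [← add_mul]
    gcongr
    exact (info_anti (mul_ne_zero ha hb) hle (PMF.apply_ne_top _ _)).trans
      (info_mul_le ha hb (PMF.apply_ne_top _ _) (PMF.apply_ne_top _ _))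
  simp_rw [entropy_eq_tsum_info, tsum_mul_bind, ← ENNReal.tsum_add, ← ENNReal.tsum_mul_left]
  refine ENNReal.tsum_le_tsum fun a => (ENNReal.tsum_le_tsum (h_info a)).trans_eq ?_
  simp_rw [ENNReal.tsum_mul_left, ENNReal.tsum_add, ENNReal.tsum_mul_left, PMF.tsum_coe]
  ring

lemma le_entropy_bind {α β : Type*} (p : PMF α) (κ : α → PMF β) :
    ∑' a, p a * entropy (κ a) ≤ entropy (p.bind κ) := by
  have h_gibbs (a b) : p a * (info (κ a b) * κ a b + κ a b) ≤
      p a * (info (p.bind κ b) * κ a b + p.bind κ b) := by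
    rcases eq_or_ne (p a) 0 with ha | ha
    · simp [ha]
    rcases eq_or_ne (κ a b) 0 with hb | hb
    · simp [hb]
    have hbind : p.bind κ b ≠ 0 := (PMF.mem_support_bind_iff p κ b).2 ⟨a, ha, hb⟩
    gcongr p a * ?_
    exact info_mul_add_le_info_mul_add (PMF.coe_le_one _ _) hbind (PMF.coe_le_one _ _)
  have h := ENNReal.tsum_le_tsum fun a => ENNReal.tsum_le_tsum (h_gibbs a)
  simp_rw [ENNReal.tsum_mul_left, ENNReal.tsum_add, PMF.tsum_coe, mul_add, ENNReal.tsum_add,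
    mul_one, PMF.tsum_coe] at h
  rw [ENNReal.add_le_add_iff_right ENNReal.one_ne_top, ← tsum_mul_bind] at h
  simpa only [entropy_eq_tsum_info] using h

lemma entropy_pure {α : Type*} (a : α) : entropy (PMF.pure a) = 0 := by
  refine ENNReal.tsum_eq_zero.2 fun b => ?_
  by_cases hb : b = a <;> simp [PMF.pure_apply, hb]

/-! ### Convolution -/

section Convolution

variable {Γ : Type*} [Group Γ]

/-- The convolution of two laws on a group: the law of `x * y`, for independent `x` and `y` with
laws `μ` and `ν`. -/
def conv (μ ν : PMF Γ) : PMF Γ :=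
  μ.bind fun x => ν.map (x * ·)

lemma map_mul_left_apply (ν : PMF Γ) (x z : Γ) : ν.map (x * ·) z = ν (x⁻¹ * z) := by
  rw [PMF.map_apply, tsum_eq_single (x⁻¹ * z) fun y hy => if_neg fun h => hy (by simp [h])]
  simp

lemma conv_apply (μ ν : PMF Γ) (z : Γ) : conv μ ν z = ∑' x, μ x * ν (x⁻¹ * z) := by
  simp only [conv, PMF.bind_apply, map_mul_left_apply]

lemma tsum_mul_conv (μ ν : PMF Γ) (f : Γ → ℝ≥0∞) :
    ∑' z, f z * conv μ ν z = ∑' x, ∑' y, f (x * y) * (μ x * ν y) := by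
  rw [conv, tsum_mul_bind]
  refine tsum_congr fun x => ?_
  rw [← (Equiv.mulLeft x).tsum_eq, ← ENNReal.tsum_mul_left]
  refine tsum_congr fun y => ?_
  rw [Equiv.coe_mulLeft, map_mul_left_apply, inv_mul_cancel_left, mul_left_comm]

lemma conv_assoc (μ ν κ : PMF Γ) : conv (conv μ ν) κ = conv μ (conv ν κ) := by
  simp only [conv, PMF.bind_bind, PMF.bind_map, PMF.map_bind, PMF.map_comp, Function.comp_def,
    mul_assoc]

lemma pure_one_conv (μ : PMF Γ) : conv (PMF.pure 1) μ = μ := by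
  simp only [conv, PMF.pure_bind, one_mul]
  exact μ.map_id

lemma conv_pure_one (μ : PMF Γ) : conv μ (PMF.pure 1) = μ := by
  simp only [conv, PMF.pure_map, mul_one, PMF.bind_pure]

lemma convPow_one (μ : PMF Γ) : convPow μ 1 = μ :=
  pure_one_conv μ

lemma convPow_add (μ : PMF Γ) (m n : ℕ) :
    convPow μ (m + n) = conv (convPow μ m) (convPow μ n) := by
  induction n with
  | zero => exact (conv_pure_one _).symm
  | succ n ih =>
    calc convPow μ (m + n + 1) = conv (convPow μ (m + n)) μ := rfl
      _ = conv (convPow μ m) (convPow μ (n + 1)) := by rw [ih, conv_assoc]; rfl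

lemma convPow_succ' (μ : PMF Γ) (n : ℕ) : convPow μ (n + 1) = conv μ (convPow μ n) := by
  rw [add_comm, convPow_add, convPow_one]

lemma IsSymmetric.conv_inv {μ ν : PMF Γ} (hμ : IsSymmetric μ) (hν : IsSymmetric ν) (z : Γ) :
    conv μ ν z⁻¹ = conv ν μ z := by
  rw [conv_apply, conv_apply, ← (Equiv.mulLeft z⁻¹).tsum_eq]
  refine tsum_congr fun x => ?_
  rw [Equiv.coe_mulLeft, ← hμ, ← hν, mul_comm]
  simp

lemma isSymmetric_convPow {μ : PMF Γ} (hμ : IsSymmetric μ) (n : ℕ) :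
    IsSymmetric (convPow μ n) := by
  induction n with
  | zero => exact fun z => by classical simp [convPow, PMF.pure_apply]
  | succ n ih => exact fun z => (ih.conv_inv hμ z).trans (by rw [convPow_succ'])

lemma IsSymmetric.conv_self_one {ν : PMF Γ} (hν : IsSymmetric ν) :
    conv ν ν 1 = ∑' x, ν x ^ 2 := by
  simp only [conv_apply, mul_one, hν _, sq]

lemma IsSymmetric.conv_self_one_ne_zero {ν : PMF Γ} (hν : IsSymmetric ν) : conv ν ν 1 ≠ 0 := by
  obtain ⟨x, hx⟩ := ν.support_nonempty
  rw [hν.conv_self_one]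
  exact fun h => pow_ne_zero 2 hx (ENNReal.tsum_eq_zero.1 h x)

lemma IsSymmetric.conv_self_le_conv_self_one {ν : PMF Γ} (hν : IsSymmetric ν) (z : Γ) :
    conv ν ν z ≤ conv ν ν 1 := by
  have h_translate : ∑' x, ν (x⁻¹ * z) ^ 2 = ∑' x, ν x ^ 2 := by
    rw [← ((Equiv.inv Γ).trans (Equiv.mulRight z)).tsum_eq fun x => ν x ^ 2]
    rfl
  refine (ENNReal.pow_le_pow_left_iff two_ne_zero).1 ?_
  calc conv ν ν z ^ 2 ≤ (∑' x, ν x ^ 2) * ∑' x, ν (x⁻¹ * z) ^ 2 := by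
        rw [conv_apply]
        exact tsum_sq_le_tsum_mul_tsum_of_sq_le_mul fun x => (mul_pow _ _ 2).le
    _ = conv ν ν 1 ^ 2 := by rw [h_translate, ← sq, hν.conv_self_one]

/-! ### The asymptotic entropy -/

lemma entropy_map_mul_left (ν : PMF Γ) (x : Γ) : entropy (ν.map (x * ·)) = entropy ν := by
  simp only [entropy, map_mul_left_apply]
  exact (Equiv.mulLeft x⁻¹).tsum_eq
    fun y => ENNReal.ofReal (-((ν y).toReal * Real.log (ν y).toReal))

lemma tsum_mul_entropy_map_mul_left (μ ν : PMF Γ) :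
    ∑' x, μ x * entropy (ν.map (x * ·)) = entropy ν := by
  simp only [entropy_map_mul_left, ENNReal.tsum_mul_right, PMF.tsum_coe, one_mul]

lemma entropy_conv_le (μ ν : PMF Γ) : entropy (conv μ ν) ≤ entropy μ + entropy ν :=
  (entropy_bind_le _ _).trans_eq (by rw [tsum_mul_entropy_map_mul_left])

lemma entropy_le_entropy_conv (μ ν : PMF Γ) : entropy ν ≤ entropy (conv μ ν) :=
  (tsum_mul_entropy_map_mul_left μ ν).symm.trans_le (le_entropy_bind _ _)

lemma entropy_convPow_ne_top {μ : PMF Γ} (h : entropy μ ≠ ∞) (n : ℕ) :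
    entropy (convPow μ n) ≠ ∞ := by
  refine ne_top_of_le_ne_top (ENNReal.mul_ne_top (ENNReal.natCast_ne_top n) h) ?_
  have := le_mul_of_subadditive (u := fun n => entropy (convPow μ n)) (entropy_pure 1)
    (fun m n => convPow_add μ m n ▸ entropy_conv_le _ _) n
  rwa [convPow_one] at this

lemma tendsto_entropy_convPow_div_top {μ : PMF Γ} (h : entropy μ = ∞) :
    Tendsto (fun n : ℕ => entropy (convPow μ n) / n) atTop (𝓝 ∞) := by
  have h_top (n : ℕ) : entropy (convPow μ (n + 1)) = ∞ :=
    top_le_iff.1 (h ▸ entropy_le_entropy_conv _ μ)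
  refine tendsto_const_nhds.congr' ?_
  filter_upwards [eventually_gt_atTop 0] with n hn
  rw [← Nat.sub_add_cancel hn, h_top, ENNReal.top_div_of_ne_top (ENNReal.natCast_ne_top _)]

lemma tendsto_entropy_convPow_div (μ : PMF Γ) :
    Tendsto (fun n : ℕ => entropy (convPow μ n) / n) atTop (𝓝 (asymptoticEntropy μ)) := by
  refine tendsto_nhds_limUnder ?_
  by_cases h : entropy μ = ∞
  · exact ⟨∞, tendsto_entropy_convPow_div_top h⟩
  · obtain ⟨L, hL, -⟩ := exists_tendsto_div_of_subadditive
      (fun m n => convPow_add μ m n ▸ entropy_conv_le _ _) (entropy_convPow_ne_top h)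
    exact ⟨L, hL⟩

lemma entropy_ne_top_of_asymptoticEntropy_ne_top {μ : PMF Γ} (h : asymptoticEntropy μ ≠ ∞) :
    entropy μ ≠ ∞ := fun h_top =>
  h (tendsto_nhds_unique (tendsto_entropy_convPow_div μ) (tendsto_entropy_convPow_div_top h_top))

/-! ### The drift -/

section Metric

variable [MetricSpace Γ]

lemma meanLength_pure_one : meanLength (PMF.pure (1 : Γ)) = 0 := by
  refine ENNReal.tsum_eq_zero.2 fun x => ?_
  by_cases hx : x = 1 <;> simp [PMF.pure_apply, hx]

lemma M₂_sq (ν : PMF Γ) : M₂ ν ^ 2 = ∑' x, edist x 1 ^ 2 * ν x := by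
  rw [M₂, ← ENNReal.rpow_natCast, ← ENNReal.rpow_mul]
  simp

lemma meanLength_sq_le (ν : PMF Γ) : meanLength ν ^ 2 ≤ M₂ ν ^ 2 * (1 - ν 1) := by
  classical
  rw [M₂_sq, ← tsum_ite_zero_apply]
  refine tsum_sq_le_tsum_mul_tsum_of_sq_le_mul fun x => ?_
  rcases eq_or_ne x 1 with rfl | hx
  · simp
  · rw [if_neg hx]
    exact le_of_eq (by ring)

lemma meanLength_le_M₂ (ν : PMF Γ) : meanLength ν ≤ M₂ ν := by
  refine (ENNReal.pow_le_pow_left_iff two_ne_zero).1 ((meanLength_sq_le ν).trans ?_)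
  exact mul_le_of_le_one_right' tsub_le_self

variable [IsIsometricSMul Γ Γ]

lemma edist_mul_one_le (x y : Γ) : edist (x * y) 1 ≤ edist x 1 + edist y 1 := by
  calc edist (x * y) 1 ≤ edist (x * y) (x * 1) + edist (x * 1) 1 := edist_triangle _ _ _
    _ = edist x 1 + edist y 1 := by rw [edist_mul_left, mul_one, add_comm]

lemma meanLength_conv_le (μ ν : PMF Γ) :
    meanLength (conv μ ν) ≤ meanLength μ + meanLength ν := by
  rw [meanLength, tsum_mul_conv]
  calc ∑' x, ∑' y, edist (x * y) 1 * (μ x * ν y)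
      ≤ ∑' x, ∑' y, (edist x 1 * μ x * ν y + μ x * (edist y 1 * ν y)) := by
        refine ENNReal.tsum_le_tsum fun x => ENNReal.tsum_le_tsum fun y => ?_
        calc edist (x * y) 1 * (μ x * ν y) ≤ (edist x 1 + edist y 1) * (μ x * ν y) := by
              gcongr
              exact edist_mul_one_le x y
          _ = edist x 1 * μ x * ν y + μ x * (edist y 1 * ν y) := by ring
    _ = meanLength μ + meanLength ν := by
        simp_rw [ENNReal.tsum_add, ← tsum_mul_tsum, PMF.tsum_coe, mul_one, one_mul, meanLength]

lemma M₂_conv_le (μ ν : PMF Γ) : M₂ (conv μ ν) ≤ M₂ μ + M₂ ν := by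
  refine (ENNReal.pow_le_pow_left_iff two_ne_zero).1 ?_
  rw [M₂_sq, tsum_mul_conv]
  calc ∑' x, ∑' y, edist (x * y) 1 ^ 2 * (μ x * ν y)
      ≤ ∑' x, ∑' y, (edist x 1 ^ 2 * μ x * ν y + 2 * (edist x 1 * μ x * (edist y 1 * ν y)) +
          μ x * (edist y 1 ^ 2 * ν y)) := by
        refine ENNReal.tsum_le_tsum fun x => ENNReal.tsum_le_tsum fun y => ?_
        calc edist (x * y) 1 ^ 2 * (μ x * ν y)
            ≤ (edist x 1 + edist y 1) ^ 2 * (μ x * ν y) := by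
              gcongr
              exact edist_mul_one_le x y
          _ = edist x 1 ^ 2 * μ x * ν y + 2 * (edist x 1 * μ x * (edist y 1 * ν y)) +
              μ x * (edist y 1 ^ 2 * ν y) := by ring
    _ = M₂ μ ^ 2 + 2 * (meanLength μ * meanLength ν) + M₂ ν ^ 2 := by
        simp_rw [ENNReal.tsum_add, ENNReal.tsum_mul_left (a := (2 : ℝ≥0∞)), ← tsum_mul_tsum,
          PMF.tsum_coe, mul_one, one_mul, M₂_sq, meanLength]
    _ ≤ M₂ μ ^ 2 + 2 * (M₂ μ * M₂ ν) + M₂ ν ^ 2 := by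
        gcongr <;> exact meanLength_le_M₂ _
    _ = (M₂ μ + M₂ ν) ^ 2 := by ring

variable {μ : PMF Γ}

lemma meanLength_convPow_le (μ : PMF Γ) (n : ℕ) :
    meanLength (convPow μ n) ≤ n * meanLength μ := by
  have := le_mul_of_subadditive (u := fun n => meanLength (convPow μ n)) meanLength_pure_one
    (fun m n => convPow_add μ m n ▸ meanLength_conv_le _ _) n
  rwa [convPow_one] at this

lemma exists_tendsto_meanLength_convPow_div (h : meanLength μ ≠ ∞) :
    ∃ L, Tendsto (fun n : ℕ => meanLength (convPow μ n) / n) atTop (𝓝 L) ∧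
      ∀ n : ℕ, n * L ≤ meanLength (convPow μ n) :=
  exists_tendsto_div_of_subadditive (fun m n => convPow_add μ m n ▸ meanLength_conv_le _ _)
    fun n => ne_top_of_le_ne_top (ENNReal.mul_ne_top (ENNReal.natCast_ne_top n) h)
      (meanLength_convPow_le μ n)

lemma tendsto_meanLength_convPow_div (h : meanLength μ ≠ ∞) :
    Tendsto (fun n : ℕ => meanLength (convPow μ n) / n) atTop (𝓝 (drift μ)) := by
  obtain ⟨L, hL, -⟩ := exists_tendsto_meanLength_convPow_div h
  exact tendsto_nhds_limUnder ⟨L, hL⟩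

lemma mul_drift_le (h : meanLength μ ≠ ∞) (n : ℕ) : n * drift μ ≤ meanLength (convPow μ n) := by
  obtain ⟨L, hL, hle⟩ := exists_tendsto_meanLength_convPow_div h
  exact tendsto_nhds_unique (tendsto_meanLength_convPow_div h) hL ▸ hle n

lemma drift_le_meanLength (h : meanLength μ ≠ ∞) : drift μ ≤ meanLength μ := by
  simpa [convPow_one] using mul_drift_le h 1

/-- Two steps of a symmetric walk return to `1` with positive probability, which makes the
Cauchy–Schwarz inequality for their length strict. -/
lemma drift_lt_M₂ (hμ : IsSymmetric μ) (h : M₂ μ ≠ ∞) (h0 : M₂ μ ≠ 0) : drift μ < M₂ μ := by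
  have h_two : 2 * drift μ ≤ meanLength (conv μ μ) := by
    have := mul_drift_le (ne_top_of_le_ne_top h (meanLength_le_M₂ μ)) (1 + 1)
    rwa [convPow_add, convPow_one, Nat.cast_add, Nat.cast_one, one_add_one_eq_two] at this
  have h_return : 1 - conv μ μ 1 < 1 :=
    ENNReal.sub_lt_self ENNReal.one_ne_top one_ne_zero hμ.conv_self_one_ne_zero
  have h_sq : (2 * drift μ) ^ 2 < (2 * M₂ μ) ^ 2 :=
    calc (2 * drift μ) ^ 2 ≤ meanLength (conv μ μ) ^ 2 := by gcongr
      _ ≤ M₂ (conv μ μ) ^ 2 * (1 - conv μ μ 1) := meanLength_sq_le _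
      _ ≤ (2 * M₂ μ) ^ 2 * (1 - conv μ μ 1) := by
          gcongr
          exact (M₂_conv_le μ μ).trans_eq (two_mul _).symm
      _ < (2 * M₂ μ) ^ 2 * 1 := by
          refine (ENNReal.mul_lt_mul_iff_right (by simp [h0]) ?_).2 h_return
          exact ENNReal.pow_ne_top (ENNReal.mul_ne_top ENNReal.ofNat_ne_top h)
      _ = (2 * M₂ μ) ^ 2 := mul_one _
  exact (ENNReal.mul_lt_mul_iff_right two_ne_zero ENNReal.ofNat_ne_top).1
    (lt_of_pow_lt_pow_left' 2 h_sq)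

lemma drift_eq_zero_of_M₂_eq_zero (h : M₂ μ = 0) : drift μ = 0 := by
  have h_mean : meanLength μ ≤ 0 := h ▸ meanLength_le_M₂ μ
  exact nonpos_iff_eq_zero.1
    ((drift_le_meanLength (ne_top_of_le_ne_top ENNReal.zero_ne_top h_mean)).trans h_mean)

lemma drift_div_M₂_lt_one (hμ : IsSymmetric μ) (h : M₂ μ ≠ ∞) : drift μ / M₂ μ < 1 := by
  by_cases h0 : M₂ μ = 0
  · simp [drift_eq_zero_of_M₂_eq_zero h0]
  · exact ENNReal.div_lt_of_lt_mul (by simpa using drift_lt_M₂ hμ h h0)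

end Metric

end Convolution

/-! ### The spectral radius -/

section Spectral

variable {Γ : Type*} [Group Γ]

/-- The Markov operator of the random walk whose increments have law `ν`. On densities, it is the
convolution with `ν`. -/
def markov (ν : PMF Γ) (u : Γ → ℝ≥0∞) (x : Γ) : ℝ≥0∞ :=
  ∑' g, ν g * u (g⁻¹ * x)

lemma markov_conv (μ ν : PMF Γ) (u : Γ → ℝ≥0∞) :
    markov (conv μ ν) u = markov μ (markov ν u) := by
  funext x
  calc markov (conv μ ν) u x = ∑' z, u (z⁻¹ * x) * conv μ ν z := tsum_congr fun z => mul_comm _ _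
    _ = markov μ (markov ν u) x := by
        simp_rw [tsum_mul_conv, markov, ← ENNReal.tsum_mul_left]
        refine tsum_congr fun g => tsum_congr fun h => ?_
        rw [mul_inv_rev, mul_assoc h⁻¹]
        ring

lemma IsSymmetric.tsum_mul_markov {ν : PMF Γ} (hν : IsSymmetric ν) (u v : Γ → ℝ≥0∞) :
    ∑' x, u x * markov ν v x = ∑' x, markov ν u x * v x := by
  calc ∑' x, u x * markov ν v x = ∑' g, ∑' x, ν g * (u x * v (g⁻¹ * x)) := by
        simp_rw [markov, ← ENNReal.tsum_mul_left]
        rw [ENNReal.tsum_comm]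
        exact tsum_congr fun g => tsum_congr fun x => mul_left_comm _ _ _
    _ = ∑' g, ∑' x, ν g * (u (g⁻¹ * x) * v x) := by
        rw [← (Equiv.inv Γ).tsum_eq]
        refine tsum_congr fun g => ?_
        rw [← (Equiv.mulLeft g⁻¹).tsum_eq]
        simp [hν g]
    _ = ∑' x, markov ν u x * v x := by
        simp_rw [markov, ← ENNReal.tsum_mul_right]
        rw [ENNReal.tsum_comm]
        exact tsum_congr fun g => tsum_congr fun x => (mul_assoc _ _ _).symm

/-- The quadratic form `⟨u, P u⟩` of the Markov operator `P` of the random walk whose increments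
have law `ν`. -/
def quadForm (ν : PMF Γ) (u : Γ → ℝ≥0∞) : ℝ≥0∞ :=
  ∑' x, u x * markov ν u x

lemma IsSymmetric.quadForm_sq_le {ν : PMF Γ} (hν : IsSymmetric ν) (u : Γ → ℝ≥0∞) :
    quadForm ν u ^ 2 ≤ (∑' x, u x ^ 2) * quadForm (conv ν ν) u := by
  calc quadForm ν u ^ 2 ≤ (∑' x, u x ^ 2) * ∑' x, markov ν u x ^ 2 :=
        tsum_sq_le_tsum_mul_tsum_of_sq_le_mul fun x => (mul_pow _ _ 2).le
    _ = (∑' x, u x ^ 2) * quadForm (conv ν ν) u := by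
        rw [quadForm, markov_conv, hν.tsum_mul_markov]
        simp_rw [sq]

lemma IsSymmetric.quadForm_pow_le {μ : PMF Γ} (hμ : IsSymmetric μ) {u : Γ → ℝ≥0∞}
    (hu : ∑' x, u x ^ 2 ≤ 1) (k : ℕ) :
    quadForm μ u ^ 2 ^ k ≤ quadForm (convPow μ (2 ^ k)) u := by
  induction k with
  | zero => simp [convPow_one]
  | succ k ih =>
    calc quadForm μ u ^ 2 ^ (k + 1) = (quadForm μ u ^ 2 ^ k) ^ 2 := by rw [pow_succ, pow_mul]
      _ ≤ quadForm (convPow μ (2 ^ k)) u ^ 2 := by gcongr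
      _ ≤ 1 * quadForm (conv (convPow μ (2 ^ k)) (convPow μ (2 ^ k))) u :=
          ((isSymmetric_convPow hμ _).quadForm_sq_le u).trans (by gcongr)
      _ = quadForm (convPow μ (2 ^ (k + 1))) u := by
          rw [one_mul, ← convPow_add, ← two_mul, ← pow_succ']

lemma quadForm_le_of_forall_le {ν : PMF Γ} {c : ℝ≥0∞} (h : ∀ g, ν g ≤ c) (u : Γ → ℝ≥0∞) :
    quadForm ν u ≤ (∑' x, u x) ^ 2 * c := by
  have h_markov (x : Γ) : markov ν u x ≤ c * ∑' y, u y := by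
    calc markov ν u x ≤ ∑' g, c * u (g⁻¹ * x) := by
          refine ENNReal.tsum_le_tsum fun g => ?_
          gcongr
          exact h g
      _ = c * ∑' y, u y := by
          rw [ENNReal.tsum_mul_left, ← ((Equiv.inv Γ).trans (Equiv.mulRight x)).tsum_eq u]
          rfl
  calc quadForm ν u ≤ ∑' x, u x * (c * ∑' y, u y) := by
        refine ENNReal.tsum_le_tsum fun x => ?_
        gcongr
        exact h_markov x
    _ = (∑' x, u x) ^ 2 * c := by
        rw [ENNReal.tsum_mul_right]
        ring

lemma quadForm_le_of_forall_finset {ν : PMF Γ} {u : Γ → ℝ≥0∞} {c : ℝ≥0∞}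
    (h : ∀ S : Finset Γ, quadForm ν ((S : Set Γ).indicator u) ≤ c) : quadForm ν u ≤ c := by
  classical
  have h_prod (v : Γ → ℝ≥0∞) :
      quadForm ν v = ∑' p : Γ × Γ, v p.1 * (ν p.2 * v (p.2⁻¹ * p.1)) := by
    simp_rw [ENNReal.tsum_prod', quadForm, markov, ENNReal.tsum_mul_left]
  rw [h_prod, ENNReal.tsum_eq_iSup_sum]
  refine iSup_le fun s => ?_
  let S : Finset Γ := s.image Prod.fst ∪ s.image fun p => p.2⁻¹ * p.1
  refine (Finset.sum_le_sum fun p hp => ?_).trans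
    ((ENNReal.sum_le_tsum s).trans ((h_prod _).symm.trans_le (h S)))
  have h_fst : p.1 ∈ S := Finset.mem_union_left _ (Finset.mem_image_of_mem _ hp)
  have h_snd : p.2⁻¹ * p.1 ∈ S :=
    Finset.mem_union_right _ (Finset.mem_image_of_mem (fun p => p.2⁻¹ * p.1) hp)
  simp [h_fst, h_snd]

lemma convPow_one_rpow_le_one (μ : PMF Γ) (n : ℕ) :
    (convPow μ n 1).toReal ^ (1 / n : ℝ) ≤ 1 :=
  Real.rpow_le_one ENNReal.toReal_nonneg
    (ENNReal.toReal_mono ENNReal.one_ne_top (PMF.coe_le_one _ _)) (by positivity)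

lemma spectralRadius_nonneg (μ : PMF Γ) : 0 ≤ spectralRadius μ :=
  le_limsup_of_frequently_le
    (.of_forall fun _ => Real.rpow_nonneg ENNReal.toReal_nonneg _)
    (isBoundedUnder_of ⟨1, convPow_one_rpow_le_one μ⟩)

lemma eventually_convPow_one_le {μ : PMF Γ} {r : ℝ} (hr : spectralRadius μ < r) :
    ∀ᶠ n in atTop, convPow μ n 1 ≤ ENNReal.ofReal r ^ n := by
  filter_upwards [eventually_lt_of_limsup_lt hr
    (isBoundedUnder_of ⟨1, convPow_one_rpow_le_one μ⟩), eventually_gt_atTop 0] with n hn hn0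
  have h_root : 0 ≤ (convPow μ n 1).toReal ^ (1 / n : ℝ) := Real.rpow_nonneg ENNReal.toReal_nonneg _
  rw [← ENNReal.ofReal_pow (h_root.trans hn.le), ← ENNReal.ofReal_toReal (PMF.apply_ne_top _ 1)]
  refine ENNReal.ofReal_le_ofReal ?_
  calc (convPow μ n 1).toReal = ((convPow μ n 1).toReal ^ (1 / n : ℝ)) ^ n := by
        rw [one_div, Real.rpow_inv_natCast_pow ENNReal.toReal_nonneg hn0.ne']
    _ ≤ r ^ n := by gcongr

lemma IsSymmetric.quadForm_le_spectralRadius_of_tsum_ne_top {μ : PMF Γ} (hμ : IsSymmetric μ)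
    {u : Γ → ℝ≥0∞} (hu : ∑' x, u x ^ 2 ≤ 1) (hu_sum : ∑' x, u x ≠ ∞) :
    quadForm μ u ≤ ENNReal.ofReal (spectralRadius μ) := by
  have h_pow (k : ℕ) : quadForm μ u ^ 2 ^ (k + 1) ≤
      (∑' x, u x) ^ 2 * convPow μ (2 ^ (k + 1)) 1 := by
    refine (hμ.quadForm_pow_le hu (k + 1)).trans (quadForm_le_of_forall_le (fun g => ?_) u)
    rw [pow_succ, mul_two, convPow_add]
    exact (isSymmetric_convPow hμ _).conv_self_le_conv_self_one g
  have h_exponent : Tendsto (fun k => 2 ^ (k + 1)) atTop (atTop : Filter ℕ) :=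
    (tendsto_pow_atTop_atTop_of_one_lt one_lt_two).comp (tendsto_add_atTop_nat 1)
  refine ENNReal.le_of_forall_pos_le_add fun δ hδ _ => ?_
  rw [← ENNReal.ofReal_coe_nnreal, ← ENNReal.ofReal_add (spectralRadius_nonneg μ) δ.coe_nonneg]
  have hr : spectralRadius μ < spectralRadius μ + δ := lt_add_of_pos_right _ hδ
  refine le_of_frequently_pow_le_mul_pow (ENNReal.pow_ne_top hu_sum (n := 2))
    (h_exponent.frequently (Eventually.frequently ?_))
  filter_upwards [h_exponent.eventually (eventually_convPow_one_le hr)] with k hk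
  exact (h_pow k).trans (by gcongr)

lemma IsSymmetric.quadForm_le_spectralRadius {μ : PMF Γ} (hμ : IsSymmetric μ)
    {u : Γ → ℝ≥0∞} (hu : ∑' x, u x ^ 2 ≤ 1) :
    quadForm μ u ≤ ENNReal.ofReal (spectralRadius μ) := by
  refine quadForm_le_of_forall_finset fun S => ?_
  have hu_top (x : Γ) : u x ≠ ∞ := fun h => by
    simpa [h] using (ENNReal.le_tsum x).trans hu
  refine hμ.quadForm_le_spectralRadius_of_tsum_ne_top (le_trans ?_ hu) ?_
  · gcongr with x
    exact Set.indicator_le_self _ _ x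
  · rw [← tsum_subtype, Finset.tsum_subtype']
    exact ENNReal.sum_ne_top.2 fun x _ => hu_top x

lemma exists_hasSum_le_of_tsum_ofReal_le {ι : Type*} {f : ι → ℝ} (hf : ∀ i, 0 ≤ f i) {r : ℝ}
    (hr : 0 ≤ r) (h : ∑' i, ENNReal.ofReal (f i) ≤ ENNReal.ofReal r) :
    ∃ s ≤ r, HasSum f s := by
  have hs : Summable f := by
    simpa only [ENNReal.toReal_ofReal (hf _)] using
      ENNReal.summable_toReal (ne_top_of_le_ne_top ENNReal.ofReal_ne_top h)
  refine ⟨_, ?_, hs.hasSum⟩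
  rwa [← ENNReal.ofReal_tsum_of_nonneg hf hs, ENNReal.ofReal_le_ofReal_iff hr] at h

lemma IsSymmetric.exists_hasSum_sqrt_le_spectralRadius {μ : PMF Γ} (hμ : IsSymmetric μ)
    (q : PMF Γ) :
    ∃ s ≤ spectralRadius μ, HasSum (fun p : Γ × Γ =>
      (μ p.1).toReal * (√(q p.2).toReal * √(q (p.1⁻¹ * p.2)).toReal)) s := by
  refine exists_hasSum_le_of_tsum_ofReal_le (fun p => by positivity) (spectralRadius_nonneg μ) ?_
  let u : Γ → ℝ≥0∞ := fun x => ENNReal.ofReal √(q x).toReal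
  have hu : ∑' x, u x ^ 2 = 1 := by
    rw [← q.tsum_coe]
    refine tsum_congr fun x => ?_
    rw [← ENNReal.ofReal_pow (Real.sqrt_nonneg _), Real.sq_sqrt ENNReal.toReal_nonneg,
      ENNReal.ofReal_toReal (q.apply_ne_top x)]
  refine le_of_eq_of_le ?_ (hμ.quadForm_le_spectralRadius hu.le)
  simp_rw [ENNReal.tsum_prod', quadForm, markov, ← ENNReal.tsum_mul_left]
  rw [ENNReal.tsum_comm]
  refine tsum_congr fun x => tsum_congr fun g => ?_
  rw [ENNReal.ofReal_mul ENNReal.toReal_nonneg, ENNReal.ofReal_mul (Real.sqrt_nonneg _),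
    ENNReal.ofReal_toReal (μ.apply_ne_top _), mul_left_comm]

end Spectral

/-! ### The walk at a geometric time -/

section GeometricTime

variable {ε : ℝ}

/-- The geometric distribution on `ℕ` with success probability `ε`, as a `PMF`. -/
def geometricPMF (hε : ε ∈ Set.Ioo 0 1) : PMF ℕ :=
  (ProbabilityTheory.geometricMeasure ⟨ε, Set.Ioo_subset_Icc_self hε⟩).toPMF

lemma geometricPMF_apply (hε : ε ∈ Set.Ioo 0 1) (n : ℕ) :
    geometricPMF hε n = ENNReal.ofReal ((1 - ε) ^ n * ε) := by
  refine ProbabilityTheory.geometricMeasure_singleton (fun h => hε.1.ne' ?_) n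
  exact congrArg Subtype.val h

lemma hasSum_geometric_mul_affine (hε : ε ∈ Set.Ioo 0 1) (a b : ℝ) :
    HasSum (fun n : ℕ => (1 - ε) ^ n * ε * (a + n * b)) (a + (1 - ε) / ε * b) := by
  have h_abs : ‖1 - ε‖ < 1 := by
    rw [Real.norm_eq_abs, abs_lt]
    constructor <;> linarith [hε.1, hε.2]
  convert! ((hasSum_geometric_of_norm_lt_one h_abs).mul_left (ε * a)).add
    ((hasSum_coe_mul_geometric_of_norm_lt_one h_abs).mul_left (ε * b)) using 1
  · funext n
    ring
  · have := hε.1.ne'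
    rw [sub_sub_cancel]
    field_simp

lemma tsum_geometricPMF_mul_affine (hε : ε ∈ Set.Ioo 0 1) {a b : ℝ} (ha : 0 ≤ a) (hb : 0 ≤ b) :
    ∑' n : ℕ, geometricPMF hε n * ENNReal.ofReal (a + n * b) =
      ENNReal.ofReal (a + (1 - ε) / ε * b) := by
  have h := hasSum_geometric_mul_affine hε a b
  have hw (n : ℕ) : 0 ≤ (1 - ε) ^ n * ε := mul_nonneg (pow_nonneg (sub_nonneg.2 hε.2.le) n) hε.1.le
  rw [← h.tsum_eq, ENNReal.ofReal_tsum_of_nonneg (fun n => mul_nonneg (hw n) (by positivity))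
    h.summable]
  exact tsum_congr fun n => by rw [geometricPMF_apply, ENNReal.ofReal_mul (hw n)]

lemma entropy_geometricPMF (hε : ε ∈ Set.Ioo 0 1) :
    entropy (geometricPMF hε) =
      ENNReal.ofReal (-Real.log ε + (1 - ε) / ε * -Real.log (1 - ε)) := by
  have h₁ : 0 < 1 - ε := sub_pos.2 hε.2
  rw [← tsum_geometricPMF_mul_affine hε (neg_nonneg.2 (Real.log_nonpos hε.1.le hε.2.le))
    (neg_nonneg.2 (Real.log_nonpos h₁.le (sub_le_self 1 hε.1.le))), entropy_eq_tsum_info]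
  refine tsum_congr fun n => ?_
  rw [mul_comm, info, geometricPMF_apply,
    ENNReal.toReal_ofReal (mul_nonneg (pow_nonneg h₁.le n) hε.1.le),
    Real.log_mul (pow_pos h₁ n).ne' hε.1.ne', Real.log_pow]
  congr 2
  ring

variable {Γ : Type*} [Group Γ]

/-- The law of the random walk stopped at an independent geometric time; as a function, it is
`ε ∑ (1 - ε)ⁿ μ^{*n}`, a multiple of the resolvent of the walk applied to the Dirac mass at `1`. -/
def resolvent (μ : PMF Γ) (hε : ε ∈ Set.Ioo 0 1) : PMF Γ :=
  (geometricPMF hε).bind (convPow μ)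

lemma resolvent_apply (μ : PMF Γ) (hε : ε ∈ Set.Ioo 0 1) (x : Γ) :
    resolvent μ hε x = ENNReal.ofReal ε * PMF.pure 1 x +
      ENNReal.ofReal (1 - ε) * markov μ (resolvent μ hε) x := by
  have h_succ (n : ℕ) :
      geometricPMF hε (n + 1) = ENNReal.ofReal (1 - ε) * geometricPMF hε n := by
    rw [geometricPMF_apply, geometricPMF_apply, ← ENNReal.ofReal_mul (sub_nonneg.2 hε.2.le),
      pow_succ', mul_assoc]
  calc resolvent μ hε x = geometricPMF hε 0 * convPow μ 0 x +
        ∑' n, geometricPMF hε (n + 1) * convPow μ (n + 1) x := by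
        rw [resolvent, PMF.bind_apply, tsum_eq_zero_add' ENNReal.summable]
    _ = ENNReal.ofReal ε * PMF.pure 1 x +
        ENNReal.ofReal (1 - ε) * ∑' n, geometricPMF hε n * ∑' g, μ g * convPow μ n (g⁻¹ * x) := by
        rw [geometricPMF_apply, pow_zero, one_mul, convPow, ← ENNReal.tsum_mul_left]
        simp_rw [h_succ, convPow_succ', conv_apply, mul_assoc]
    _ = ENNReal.ofReal ε * PMF.pure 1 x +
        ENNReal.ofReal (1 - ε) * markov μ (resolvent μ hε) x := by
        simp_rw [markov, resolvent, PMF.bind_apply, ← ENNReal.tsum_mul_left]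
        rw [ENNReal.tsum_comm]
        simp_rw [mul_left_comm]

lemma resolvent_inv_mul_eq_zero {μ : PMF Γ} (hε : ε ∈ Set.Ioo 0 1) {g x : Γ} (hg : μ g ≠ 0)
    (hx : resolvent μ hε x = 0) : resolvent μ hε (g⁻¹ * x) = 0 := by
  rw [resolvent_apply, add_eq_zero, mul_eq_zero, mul_eq_zero] at hx
  have h_markov := hx.2.resolve_left (ENNReal.ofReal_pos.2 (sub_pos.2 hε.2)).ne'
  exact (mul_eq_zero.1 (ENNReal.tsum_eq_zero.1 h_markov g)).resolve_left hg

lemma IsSymmetric.resolvent_eq_zero_iff {μ : PMF Γ} (hμ : IsSymmetric μ) (hε : ε ∈ Set.Ioo 0 1)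
    {g : Γ} (hg : μ g ≠ 0) (x : Γ) :
    resolvent μ hε x = 0 ↔ resolvent μ hε (g⁻¹ * x) = 0 := by
  refine ⟨resolvent_inv_mul_eq_zero hε hg, fun h => ?_⟩
  simpa only [inv_inv, mul_inv_cancel_left] using
    resolvent_inv_mul_eq_zero hε (g := g⁻¹) (by rwa [hμ]) h

lemma entropy_resolvent_le {μ : PMF Γ} (hε : ε ∈ Set.Ioo 0 1) {C s : ℝ} (hC : 0 ≤ C) (hs : 0 ≤ s)
    (h : ∀ n : ℕ, entropy (convPow μ n) ≤ ENNReal.ofReal (C + n * s)) :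
    entropy (resolvent μ hε) ≤
      ENNReal.ofReal (C - Real.log ε + (1 - ε) / ε * (s - Real.log (1 - ε))) := by
  have h₀ := hε.1
  have h₁ : 0 < 1 - ε := sub_pos.2 hε.2
  have h_log : 0 ≤ -Real.log ε := neg_nonneg.2 (Real.log_nonpos hε.1.le hε.2.le)
  have h_log' : 0 ≤ -Real.log (1 - ε) :=
    neg_nonneg.2 (Real.log_nonpos h₁.le (sub_le_self 1 hε.1.le))
  calc entropy (resolvent μ hε)
      ≤ entropy (geometricPMF hε) + ∑' n, geometricPMF hε n * entropy (convPow μ n) :=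
        entropy_bind_le _ _
    _ ≤ entropy (geometricPMF hε) + ∑' n : ℕ, geometricPMF hε n * ENNReal.ofReal (C + n * s) := by
        gcongr with n
        exact h n
    _ = ENNReal.ofReal (C - Real.log ε + (1 - ε) / ε * (s - Real.log (1 - ε))) := by
        rw [tsum_geometricPMF_mul_affine hε hC hs, entropy_geometricPMF,
          ← ENNReal.ofReal_add (by positivity) (by positivity)]
        congr 1
        ring

lemma tsum_geometricPMF_mul_natCast_mul (hε : ε ∈ Set.Ioo 0 1) {b : ℝ≥0∞} (hb : b ≠ ∞) :
    ∑' n : ℕ, geometricPMF hε n * (n * b) = ENNReal.ofReal ((1 - ε) / ε * b.toReal) := by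
  have h := tsum_geometricPMF_mul_affine hε le_rfl (ENNReal.toReal_nonneg (a := b))
  simpa only [zero_add, ENNReal.ofReal_mul (Nat.cast_nonneg _), ENNReal.ofReal_natCast,
    ENNReal.ofReal_toReal hb] using h

lemma meanLength_resolvent [MetricSpace Γ] (μ : PMF Γ) (hε : ε ∈ Set.Ioo 0 1) :
    meanLength (resolvent μ hε) = ∑' n, geometricPMF hε n * meanLength (convPow μ n) :=
  tsum_mul_bind _ _ _

variable [MetricSpace Γ] [IsIsometricSMul Γ Γ] {μ : PMF Γ}

lemma le_meanLength_resolvent (hε : ε ∈ Set.Ioo 0 1) (h : meanLength μ ≠ ∞) :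
    ENNReal.ofReal ((1 - ε) / ε * (drift μ).toReal) ≤ meanLength (resolvent μ hε) := by
  rw [← tsum_geometricPMF_mul_natCast_mul hε (ne_top_of_le_ne_top h (drift_le_meanLength h)),
    meanLength_resolvent]
  gcongr with n
  exact mul_drift_le h n

lemma meanLength_resolvent_ne_top (hε : ε ∈ Set.Ioo 0 1) (h : meanLength μ ≠ ∞) :
    meanLength (resolvent μ hε) ≠ ∞ := by
  refine ne_top_of_le_ne_top ENNReal.ofReal_ne_top (le_of_le_of_eq ?_
    (tsum_geometricPMF_mul_natCast_mul hε h))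
  rw [meanLength_resolvent]
  gcongr with n
  exact meanLength_convPow_le μ n

end GeometricTime

/-! ### Sums over the edges of the walk -/

section Edges

lemma sq_le_mul_of_hasSum {ι : Type*} {r f g : ι → ℝ} {a b c : ℝ} (hr : HasSum r c)
    (hf : HasSum f a) (hg : HasSum g b) (hf₀ : ∀ i, 0 ≤ f i) (hg₀ : ∀ i, 0 ≤ g i)
    (h : ∀ i, r i ^ 2 ≤ f i * g i) : c ^ 2 ≤ a * b :=
  le_of_tendsto_of_tendsto' (Tendsto.pow hr 2) (Tendsto.mul hf hg) fun s =>
    Finset.sum_sq_le_sum_mul_sum_of_sq_le_mul s (fun i _ => hf₀ i) (fun i _ => hg₀ i) fun i _ => h i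

lemma hasSum_toReal_of_tsum_eq {ι : Type*} {f : ι → ℝ≥0∞} {a : ℝ≥0∞} (h : ∑' i, f i = a)
    (ha : a ≠ ∞) : HasSum (fun i => (f i).toReal) a.toReal := by
  subst h
  rw [ENNReal.tsum_toReal_eq (ENNReal.ne_top_of_tsum_ne_top ha)]
  exact ENNReal.hasSum_toReal ha

lemma hasSum_toReal {α : Type*} (ν : PMF α) : HasSum (fun x => (ν x).toReal) 1 := by
  simpa only [ENNReal.toReal_one] using hasSum_toReal_of_tsum_eq ν.tsum_coe ENNReal.one_ne_top

lemma log_toReal_nonpos {α : Type*} (ν : PMF α) (x : α) : Real.log (ν x).toReal ≤ 0 :=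
  Real.log_nonpos ENNReal.toReal_nonneg
    (ENNReal.toReal_mono ENNReal.one_ne_top (ν.coe_le_one x))

lemma hasSum_neg_log_mul {α : Type*} {ν : PMF α} (h : entropy ν ≠ ∞) :
    HasSum (fun x => -Real.log (ν x).toReal * (ν x).toReal) (entropy ν).toReal := by
  refine (hasSum_toReal_of_tsum_eq (entropy_eq_tsum_info ν).symm h).congr_fun fun x => ?_
  rw [ENNReal.toReal_mul, info, ENNReal.toReal_ofReal (neg_nonneg.2 (log_toReal_nonpos ν x))]

variable {Γ : Type*} [Group Γ]

/-- A pair `(g, x)` stands for the step of the walk from `x` to `g⁻¹ * x`. This is the involution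
reversing the steps. -/
def edgeReversal (Γ : Type*) [Group Γ] : Γ × Γ ≃ Γ × Γ :=
  Equiv.prodShear (Equiv.inv Γ) fun g => Equiv.mulLeft g⁻¹

lemma hasSum_edge_swap {m : Γ → ℝ} (hm : ∀ g, m g⁻¹ = m g) {f : Γ → Γ → ℝ} {a : ℝ}
    (h : HasSum (fun p : Γ × Γ => m p.1 * f p.2 (p.1⁻¹ * p.2)) a) :
    HasSum (fun p : Γ × Γ => m p.1 * f (p.1⁻¹ * p.2) p.2) a := by
  rw [← (edgeReversal Γ).hasSum_iff] at h
  refine h.congr_fun fun p => ?_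
  simp [edgeReversal, hm]

lemma hasSum_edge_mean {m q : Γ → ℝ} {a b : ℝ} (hm_inv : ∀ g, m g⁻¹ = m g) (hm : HasSum m a)
    (hq : HasSum q b) :
    HasSum (fun p : Γ × Γ => m p.1 * ((q p.2 + q (p.1⁻¹ * p.2)) / 2)) (a * b) := by
  have h : HasSum (fun p : Γ × Γ => m p.1 * q p.2) (a * b) :=
    hm.mul hq (summable_mul_of_summable_norm hm.summable.norm hq.summable.norm)
  have h_swap := hasSum_edge_swap (f := fun x _ => q x) hm_inv h
  convert! (h.add h_swap).div_const 2 using 1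
  · funext p
    ring
  · ring

lemma hasSum_edge_mul {m q F r : Γ → ℝ} {T : ℝ} (hm₀ : ∀ g, 0 ≤ m g) (hq₀ : ∀ x, 0 ≤ q x)
    (hr : ∀ x, HasSum (fun g => m g * q (g⁻¹ * x)) (r x)) (hT : HasSum (fun x => F x * r x) T) :
    HasSum (fun p : Γ × Γ => m p.1 * (F p.2 * q (p.1⁻¹ * p.2))) T := by
  have h_abs (x : Γ) : HasSum (fun g => |F x * (m g * q (g⁻¹ * x))|) |F x * r x| := by
    have hr₀ : 0 ≤ r x := (hr x).nonneg fun g => mul_nonneg (hm₀ g) (hq₀ _)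
    simp_rw [abs_mul, abs_of_nonneg hr₀, abs_of_nonneg (hm₀ _), abs_of_nonneg (hq₀ _)]
    exact (hr x).mul_left _
  have h_summable : Summable fun p : Γ × Γ => F p.1 * (m p.2 * q (p.2⁻¹ * p.1)) := by
    refine Summable.of_abs ((summable_prod_of_nonneg fun p => abs_nonneg _).2
      ⟨fun x => (h_abs x).summable, ?_⟩)
    simp_rw [(h_abs _).tsum_eq]
    exact hT.summable.abs
  have h := h_summable.hasSum
  rw [(h.prod_fiberwise fun x => (hr x).mul_left (F x)).unique hT,
    ← (Equiv.prodComm Γ Γ).hasSum_iff] at h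
  exact h.congr_fun fun p => mul_left_comm _ _ _

lemma hasSum_edge_increment {m q F r : Γ → ℝ} {S T : ℝ} (hm_inv : ∀ g, m g⁻¹ = m g)
    (hm₀ : ∀ g, 0 ≤ m g) (hm : HasSum m 1) (hq₀ : ∀ x, 0 ≤ q x)
    (hr : ∀ x, HasSum (fun g => m g * q (g⁻¹ * x)) (r x))
    (hS : HasSum (fun x => F x * q x) S) (hT : HasSum (fun x => F x * r x) T) :
    HasSum (fun p : Γ × Γ =>
      m p.1 * ((F p.2 - F (p.1⁻¹ * p.2)) * (q (p.1⁻¹ * p.2) - q p.2) / 2)) (T - S) := by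
  have h_cross := hasSum_edge_mul hm₀ hq₀ hr hT
  have h_cross' := hasSum_edge_swap (f := fun x y => F x * q y) hm_inv h_cross
  convert! ((h_cross.add h_cross').div_const 2).sub (hasSum_edge_mean hm_inv hm hS) using 1
  · funext p
    ring
  · ring

variable {μ : PMF Γ} {ε : ℝ}

lemma IsSymmetric.toReal_inv (hμ : IsSymmetric μ) (g : Γ) : (μ g⁻¹).toReal = (μ g).toReal :=
  congrArg ENNReal.toReal (hμ g)

lemma hasSum_resolvent [DecidableEq Γ] (μ : PMF Γ) (hε : ε ∈ Set.Ioo 0 1) (x : Γ) :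
    HasSum (fun g => (μ g).toReal * (resolvent μ hε (g⁻¹ * x)).toReal)
      (((resolvent μ hε x).toReal - if x = 1 then ε else 0) / (1 - ε)) := by
  have h₁ : 0 < 1 - ε := sub_pos.2 hε.2
  have h_top : markov μ (resolvent μ hε) x ≠ ∞ := by
    refine ne_top_of_le_ne_top ENNReal.one_ne_top (μ.tsum_coe ▸ ENNReal.tsum_le_tsum fun g => ?_)
    exact mul_le_of_le_one_right' (PMF.coe_le_one _ _)
  have h : HasSum (fun g => (μ g).toReal * (resolvent μ hε (g⁻¹ * x)).toReal)
      (markov μ (resolvent μ hε) x).toReal :=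
    (hasSum_toReal_of_tsum_eq rfl h_top).congr_fun fun g => ENNReal.toReal_mul.symm
  convert h using 1
  rw [div_eq_iff h₁.ne', resolvent_apply, ENNReal.toReal_add
    (ENNReal.mul_ne_top ENNReal.ofReal_ne_top (PMF.apply_ne_top _ _))
    (ENNReal.mul_ne_top ENNReal.ofReal_ne_top h_top), ENNReal.toReal_mul, ENNReal.toReal_mul,
    ENNReal.toReal_ofReal hε.1.le, ENNReal.toReal_ofReal h₁.le]
  by_cases hx : x = 1 <;> simp [PMF.pure_apply, hx, mul_comm]

lemma IsSymmetric.hasSum_edge_increment_resolvent (hμ : IsSymmetric μ) (hε : ε ∈ Set.Ioo 0 1)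
    {F : Γ → ℝ} {S : ℝ} (hF : HasSum (fun x => F x * (resolvent μ hε x).toReal) S) :
    HasSum (fun p : Γ × Γ => (μ p.1).toReal * ((F p.2 - F (p.1⁻¹ * p.2)) *
        ((resolvent μ hε (p.1⁻¹ * p.2)).toReal - (resolvent μ hε p.2).toReal) / 2))
      (ε / (1 - ε) * (S - F 1)) := by
  classical
  have h_dirac : HasSum (fun x => F x * if x = 1 then ε else 0) (F 1 * ε) := by
    convert hasSum_ite_eq (1 : Γ) (F 1 * ε) using 2 with x
    by_cases hx : x = 1 <;> simp [hx]
  have hT : HasSum (fun x => F x *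
      (((resolvent μ hε x).toReal - if x = 1 then ε else 0) / (1 - ε)))
      ((S - F 1 * ε) / (1 - ε)) :=
    ((hF.sub h_dirac).div_const (1 - ε)).congr_fun fun x => by ring
  convert! hasSum_edge_increment (m := fun g => (μ g).toReal) hμ.toReal_inv
    (fun _ => ENNReal.toReal_nonneg) (hasSum_toReal μ) (fun _ => ENNReal.toReal_nonneg)
    (hasSum_resolvent μ hε) hF hT using 1
  have h₁ : 1 - ε ≠ 0 := (sub_pos.2 hε.2).ne'
  field_simp
  ring

/-- The mass of the edge `(g, x)` when the starting point of the walk has law `q`, symmetrized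
under the reversal of edges. -/
def edgeMass (μ q : PMF Γ) (p : Γ × Γ) : ℝ :=
  (μ p.1).toReal * (((q p.2).toReal + (q (p.1⁻¹ * p.2)).toReal) / 2)

/-- The relative increment of the density `q` along the edge `(g, x)`. -/
def edgeIncrement (q : PMF Γ) (p : Γ × Γ) : ℝ :=
  relIncrement (q p.2).toReal (q (p.1⁻¹ * p.2)).toReal

lemma edgeMass_nonneg (μ q : PMF Γ) (p : Γ × Γ) : 0 ≤ edgeMass μ q p := by
  unfold edgeMass
  positivity

lemma edgeMass_mul_edgeIncrement (μ q : PMF Γ) (p : Γ × Γ) :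
    edgeMass μ q p * edgeIncrement q p =
      (μ p.1).toReal * (((q (p.1⁻¹ * p.2)).toReal - (q p.2).toReal) / 2) := by
  rw [← add_mul_relIncrement ENNReal.toReal_nonneg ENNReal.toReal_nonneg, edgeMass, edgeIncrement]
  ring

lemma abs_edgeIncrement_le_one (q : PMF Γ) (p : Γ × Γ) : |edgeIncrement q p| ≤ 1 :=
  abs_relIncrement_le_one ENNReal.toReal_nonneg ENNReal.toReal_nonneg

lemma IsSymmetric.hasSum_edgeMass (hμ : IsSymmetric μ) (q : PMF Γ) :
    HasSum (edgeMass μ q) 1 := by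
  have h := hasSum_edge_mean (m := fun g => (μ g).toReal) hμ.toReal_inv (hasSum_toReal μ)
    (hasSum_toReal q)
  rwa [mul_one] at h

lemma IsSymmetric.summable_edgeMass_mul_sq (hμ : IsSymmetric μ) (q : PMF Γ) :
    Summable fun p => edgeMass μ q p * edgeIncrement q p ^ 2 :=
  (hμ.hasSum_edgeMass q).summable.of_nonneg_of_le
    (fun p => mul_nonneg (edgeMass_nonneg μ q p) (sq_nonneg _)) fun p =>
      mul_le_of_le_one_right (edgeMass_nonneg μ q p)
        ((sq_le_one_iff_abs_le_one _).2 (abs_edgeIncrement_le_one q p))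

lemma IsSymmetric.toReal_resolvent_eq_zero_iff (hμ : IsSymmetric μ) (hε : ε ∈ Set.Ioo 0 1)
    {g : Γ} (hg : (μ g).toReal ≠ 0) (x : Γ) :
    (resolvent μ hε x).toReal = 0 ↔ (resolvent μ hε (g⁻¹ * x)).toReal = 0 := by
  simpa only [ENNReal.toReal_eq_zero_iff, PMF.apply_ne_top, or_false] using
    hμ.resolvent_eq_zero_iff hε (fun h => hg (by rw [h, ENNReal.toReal_zero])) x

lemma IsSymmetric.edgeIncrement_mem_Ioo (hμ : IsSymmetric μ) (hε : ε ∈ Set.Ioo 0 1) {p : Γ × Γ}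
    (hp : edgeMass μ (resolvent μ hε) p ≠ 0) :
    edgeIncrement (resolvent μ hε) p ∈ Set.Ioo (-1) 1 := by
  have h_iff := hμ.toReal_resolvent_eq_zero_iff hε (left_ne_zero_of_mul hp) p.2
  have hx : (resolvent μ hε p.2).toReal ≠ 0 := fun hx =>
    hp (by rw [edgeMass, h_iff.1 hx, hx, add_zero, zero_div, mul_zero])
  exact relIncrement_mem_Ioo (ENNReal.toReal_nonneg.lt_of_ne' hx)
    (ENNReal.toReal_nonneg.lt_of_ne' (mt h_iff.2 hx))

lemma IsSymmetric.hasSum_edgeMass_mul_A (hμ : IsSymmetric μ) (hε : ε ∈ Set.Ioo 0 1)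
    (hH : entropy (resolvent μ hε) ≠ ∞) {s : ℝ}
    (hs : HasSum (fun p : Γ × Γ => (μ p.1).toReal *
      (√(resolvent μ hε p.2).toReal * √(resolvent μ hε (p.1⁻¹ * p.2)).toReal)) s) :
    HasSum (fun p => edgeMass μ (resolvent μ hε) p * A (edgeIncrement (resolvent μ hε) p))
      (ε / (1 - ε) * ((entropy (resolvent μ hε)).toReal + Real.log (resolvent μ hε 1).toReal)
        + 4 * s - 4) := by
  have h_log := hμ.hasSum_edge_increment_resolvent hε (hasSum_neg_log_mul hH)
  convert! (h_log.add (hs.mul_left 4)).sub ((hμ.hasSum_edgeMass (resolvent μ hε)).mul_left 4)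
    using 1
  · funext p
    rcases eq_or_ne (μ p.1).toReal 0 with hm | hm
    · simp [edgeMass, hm]
    rw [edgeMass, mul_assoc, edgeIncrement, add_div_two_mul_A_relIncrement ENNReal.toReal_nonneg
      ENNReal.toReal_nonneg (hμ.toReal_resolvent_eq_zero_iff hε hm p.2)]
    ring
  · ring

section Metric

variable [MetricSpace Γ]

lemma hasSum_dist_mul {ν : PMF Γ} (h : meanLength ν ≠ ∞) :
    HasSum (fun x => dist x 1 * (ν x).toReal) (meanLength ν).toReal := by
  refine (hasSum_toReal_of_tsum_eq rfl h).congr_fun fun x => ?_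
  rw [ENNReal.toReal_mul, ← dist_edist]

lemma hasSum_mul_dist_sq {ν : PMF Γ} (h : M₂ ν ≠ ∞) :
    HasSum (fun x => (ν x).toReal * dist x 1 ^ 2) ((M₂ ν).toReal ^ 2) := by
  rw [← ENNReal.toReal_pow]
  refine (hasSum_toReal_of_tsum_eq (M₂_sq ν).symm (ENNReal.pow_ne_top h)).congr_fun fun x => ?_
  rw [ENNReal.toReal_mul, ENNReal.toReal_pow, ← dist_edist, mul_comm]

variable [IsIsometricSMul Γ Γ]

lemma dist_inv_one (g : Γ) : dist g⁻¹ 1 = dist g 1 := by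
  rw [← dist_mul_left g, mul_inv_cancel, mul_one, dist_comm]

lemma abs_dist_one_sub_dist_inv_mul_one_le (g x : Γ) :
    |dist x 1 - dist (g⁻¹ * x) 1| ≤ dist g 1 := by
  have h : dist (g⁻¹ * x) 1 = dist x g := by
    rw [← dist_mul_left g, mul_inv_cancel_left, mul_one]
  rw [h, dist_comm x 1, dist_comm x g, dist_comm g 1]
  exact abs_dist_sub_le 1 g x

lemma IsSymmetric.hasSum_edgeMass_mul_dist_sq (hμ : IsSymmetric μ) (hM : M₂ μ ≠ ∞) (q : PMF Γ) :
    HasSum (fun p => edgeMass μ q p * dist p.1 1 ^ 2) ((M₂ μ).toReal ^ 2) := by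
  have h := hasSum_edge_mean (fun g => by rw [hμ, dist_inv_one]) (hasSum_mul_dist_sq hM)
    (hasSum_toReal q)
  rw [mul_one] at h
  exact h.congr_fun fun p => mul_right_comm _ _ _

lemma IsSymmetric.exists_hasSum_drift_le (hμ : IsSymmetric μ) (h : meanLength μ ≠ ∞)
    (hε : ε ∈ Set.Ioo 0 1) :
    ∃ D, (drift μ).toReal ≤ D ∧ HasSum (fun p : Γ × Γ => edgeMass μ (resolvent μ hε) p *
      edgeIncrement (resolvent μ hε) p * (dist p.2 1 - dist (p.1⁻¹ * p.2) 1)) D := by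
  have h_top := meanLength_resolvent_ne_top hε h
  refine ⟨_, ?_, (hμ.hasSum_edge_increment_resolvent hε (hasSum_dist_mul h_top)).congr_fun
    fun p => ?_⟩
  · have h₀ := hε.1
    have h₁ : 0 < 1 - ε := sub_pos.2 hε.2
    have h_le := ENNReal.toReal_mono h_top (le_meanLength_resolvent hε h)
    rw [ENNReal.toReal_ofReal (by positivity)] at h_le
    calc (drift μ).toReal = ε / (1 - ε) * ((1 - ε) / ε * (drift μ).toReal) := by field_simp
      _ ≤ ε / (1 - ε) * ((meanLength (resolvent μ hε)).toReal - dist (1 : Γ) 1) := by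
        rw [dist_self, sub_zero]
        gcongr
  · rw [edgeMass_mul_edgeIncrement]
    ring

lemma IsSymmetric.drift_sq_le (hμ : IsSymmetric μ) (hM : M₂ μ ≠ ∞) (hε : ε ∈ Set.Ioo 0 1) :
    (drift μ).toReal ^ 2 ≤ (∑' p : Γ × Γ, edgeMass μ (resolvent μ hε) p *
      edgeIncrement (resolvent μ hε) p ^ 2) * (M₂ μ).toReal ^ 2 := by
  obtain ⟨D, h_drift, hD⟩ :=
    hμ.exists_hasSum_drift_le (ne_top_of_le_ne_top hM (meanLength_le_M₂ μ)) hε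
  refine (pow_le_pow_left₀ ENNReal.toReal_nonneg h_drift 2).trans
    (sq_le_mul_of_hasSum hD (hμ.summable_edgeMass_mul_sq (resolvent μ hε)).hasSum
      (hμ.hasSum_edgeMass_mul_dist_sq hM (resolvent μ hε))
      (fun p => mul_nonneg (edgeMass_nonneg _ _ p) (sq_nonneg _))
      (fun p => mul_nonneg (edgeMass_nonneg _ _ p) (sq_nonneg _)) fun p => ?_)
  have h_dist := sq_le_sq.2 ((abs_dist_one_sub_dist_inv_mul_one_le p.1 p.2).trans (le_abs_self _))
  exact (mul_pow _ _ 2).trans_le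
    ((mul_le_mul_of_nonneg_left h_dist (sq_nonneg _)).trans_eq (by ring))

lemma IsSymmetric.sq_drift_div_M₂_le (hμ : IsSymmetric μ) (hM : M₂ μ ≠ ∞)
    (hε : ε ∈ Set.Ioo 0 1) :
    (drift μ / M₂ μ).toReal ^ 2 ≤ ∑' p : Γ × Γ, edgeMass μ (resolvent μ hε) p *
      edgeIncrement (resolvent μ hε) p ^ 2 := by
  have h_nonneg : 0 ≤ ∑' p : Γ × Γ, edgeMass μ (resolvent μ hε) p *
      edgeIncrement (resolvent μ hε) p ^ 2 :=
    tsum_nonneg fun p => mul_nonneg (edgeMass_nonneg _ _ p) (sq_nonneg _)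
  rw [ENNReal.toReal_div, div_pow]
  exact div_le_of_le_mul₀ (sq_nonneg _) h_nonneg (hμ.drift_sq_le hM hε)

lemma toReal_drift_div_M₂_lt_one (hμ : IsSymmetric μ) (hM : M₂ μ ≠ ∞) :
    (drift μ / M₂ μ).toReal < 1 := by
  simpa only [ENNReal.toReal_one] using
    ENNReal.toReal_strict_mono ENNReal.one_ne_top (drift_div_M₂_lt_one hμ hM)

lemma IsSymmetric.A_add_le_entropy_resolvent (hμ : IsSymmetric μ) (hM : M₂ μ ≠ ∞)
    (hε : ε ∈ Set.Ioo 0 1) (hH : entropy (resolvent μ hε) ≠ ∞) :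
    A (drift μ / M₂ μ).toReal + 4 * (1 - spectralRadius μ) ≤
      ε / (1 - ε) * (entropy (resolvent μ hε)).toReal := by
  obtain ⟨s, hsρ, hs⟩ := hμ.exists_hasSum_sqrt_le_spectralRadius (resolvent μ hε)
  have h_jensen := A_le_of_hasSum (edgeMass_nonneg μ _) (hμ.hasSum_edgeMass _)
    (fun p => hμ.edgeIncrement_mem_Ioo hε) (hμ.hasSum_edgeMass_mul_A hε hH hs)
    (hμ.summable_edgeMass_mul_sq _).hasSum ENNReal.toReal_nonneg
    (toReal_drift_div_M₂_lt_one hμ hM) (hμ.sq_drift_div_M₂_le hM hε)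
  have h_log : ε / (1 - ε) * Real.log (resolvent μ hε 1).toReal ≤ 0 :=
    mul_nonpos_of_nonneg_of_nonpos (div_nonneg hε.1.le (sub_nonneg.2 hε.2.le))
      (log_toReal_nonpos _ 1)
  linarith

end Metric

end Edges

/-! ### The limit -/

section Limit

variable {Γ : Type*} [Group Γ] {μ : PMF Γ}

lemma exists_entropy_convPow_le {s : ℝ} (hs : 0 ≤ s)
    (h : asymptoticEntropy μ < ENNReal.ofReal s) :
    ∃ C : ℝ, 0 ≤ C ∧ ∀ n : ℕ, entropy (convPow μ n) ≤ ENNReal.ofReal (C + n * s) := by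
  have h_top := entropy_convPow_ne_top (entropy_ne_top_of_asymptoticEntropy_ne_top h.ne_top)
  obtain ⟨N, hN⟩ := eventually_atTop.1 ((tendsto_entropy_convPow_div μ).eventually_le_const h)
  refine ⟨∑ k ∈ Finset.range (N + 1), (entropy (convPow μ k)).toReal,
    Finset.sum_nonneg fun _ _ => ENNReal.toReal_nonneg, fun n => ?_⟩
  rcases lt_or_ge n (N + 1) with hn | hn
  · rw [← ENNReal.ofReal_toReal (h_top n)]
    refine ENNReal.ofReal_le_ofReal (le_add_of_le_of_nonneg ?_ (by positivity))
    exact Finset.single_le_sum (f := fun k => (entropy (convPow μ k)).toReal)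
      (fun _ _ => ENNReal.toReal_nonneg) (Finset.mem_range.2 hn)
  · have hn₀ : (n : ℝ≥0∞) ≠ 0 := Nat.cast_ne_zero.2 (by lia)
    calc entropy (convPow μ n) ≤ ENNReal.ofReal s * n :=
          (ENNReal.div_le_iff hn₀ (ENNReal.natCast_ne_top n)).1 (hN n (by lia))
      _ = ENNReal.ofReal (n * s) := by
          rw [ENNReal.ofReal_mul n.cast_nonneg, ENNReal.ofReal_natCast, mul_comm]
      _ ≤ _ := ENNReal.ofReal_le_ofReal (le_add_of_nonneg_left
          (Finset.sum_nonneg fun _ _ => ENNReal.toReal_nonneg))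

lemma tendsto_entropy_resolvent_bound (C s : ℝ) :
    Tendsto (fun ε : ℝ =>
      ε / (1 - ε) * (C - Real.log ε + (1 - ε) / ε * (s - Real.log (1 - ε)))) (𝓝[>] 0) (𝓝 s) := by
  have h_cont : ContinuousAt (fun ε : ℝ =>
      ε / (1 - ε) * C + Real.negMulLog ε / (1 - ε) + s - Real.log (1 - ε)) 0 := by
    have h₁ : ContinuousAt (fun ε : ℝ => 1 - ε) 0 := by fun_prop
    have h₀ : (1 : ℝ) - 0 ≠ 0 := by norm_num
    exact ((((continuousAt_id.div h₁ h₀).mul_const C).add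
      (Real.continuous_negMulLog.continuousAt.div h₁ h₀)).add_const s).sub (h₁.log h₀)
  have h_lim := h_cont.tendsto.mono_left (nhdsWithin_le_nhds (s := Set.Ioi 0))
  simp only [zero_div, zero_mul, Real.negMulLog_zero, add_zero, zero_add, sub_zero,
    Real.log_one] at h_lim
  refine h_lim.congr' ?_
  filter_upwards [Ioo_mem_nhdsGT one_pos] with ε hε
  have h₀ : ε ≠ 0 := hε.1.ne'
  have h₁ : 1 - ε ≠ 0 := (sub_pos.2 hε.2).ne'
  rw [Real.negMulLog]
  field_simp
  ring

variable [MetricSpace Γ] [IsIsometricSMul Γ Γ]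

lemma IsSymmetric.A_add_le_asymptoticEntropy (hμ : IsSymmetric μ) (hM : M₂ μ ≠ ∞)
    (h_top : asymptoticEntropy μ ≠ ∞) :
    A (drift μ / M₂ μ).toReal + 4 * (1 - spectralRadius μ) ≤ (asymptoticEntropy μ).toReal := by
  refine le_of_forall_gt_imp_ge_of_dense fun s hs => ?_
  have hs₀ : 0 ≤ s := ENNReal.toReal_nonneg.trans hs.le
  obtain ⟨C, hC, h_entropy⟩ :=
    exists_entropy_convPow_le hs₀ ((ENNReal.lt_ofReal_iff_toReal_lt h_top).2 hs)
  refine ge_of_tendsto (tendsto_entropy_resolvent_bound C s) ?_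
  filter_upwards [Ioo_mem_nhdsGT one_pos] with ε hε
  have h₀ := hε.1
  have h₁ : 0 < 1 - ε := sub_pos.2 hε.2
  have h_log : Real.log ε ≤ 0 := Real.log_nonpos h₀.le hε.2.le
  have h_log' : Real.log (1 - ε) ≤ 0 := Real.log_nonpos h₁.le (sub_le_self 1 h₀.le)
  have h_le := entropy_resolvent_le hε hC hs₀ h_entropy
  refine (hμ.A_add_le_entropy_resolvent hM hε
    (ne_top_of_le_ne_top ENNReal.ofReal_ne_top h_le)).trans ?_
  gcongr
  exact ENNReal.toReal_le_of_le_ofReal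
    (add_nonneg (by linarith) (mul_nonneg (by positivity) (by linarith))) h_le

end Limit

lemma coe_le_coe_ennreal {a : ℝ} {b : ℝ≥0∞} (h : b ≠ ∞ → a ≤ b.toReal) : (a : EReal) ≤ b := by
  rcases eq_or_ne b ∞ with rfl | hb
  · exact le_top
  · rw [← EReal.coe_ennreal_toReal hb]
    exact_mod_cast h hb

end RandomWalk

end

theorem mainTheorem8_general {Γ : Type*} [Group Γ] [MetricSpace Γ] [IsIsometricSMul Γ Γ]
    (μ : PMF Γ) (hsymm : RandomWalk.IsSymmetric μ) (hM₂ : RandomWalk.M₂ μ ≠ ∞) :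
    (∀ x ∈ Set.Ioo (-1 : ℝ) 1, 0 ≤ RandomWalk.A x) ∧
    Tendsto (fun n : ℕ => RandomWalk.entropy (RandomWalk.convPow μ n) / n) atTop
      (𝓝 (RandomWalk.asymptoticEntropy μ)) ∧
    Tendsto (fun n : ℕ => RandomWalk.meanLength (RandomWalk.convPow μ n) / n) atTop
      (𝓝 (RandomWalk.drift μ)) ∧
    RandomWalk.drift μ / RandomWalk.M₂ μ < 1 ∧
    ((RandomWalk.A (RandomWalk.drift μ / RandomWalk.M₂ μ).toReal
        + 4 * (1 - RandomWalk.spectralRadius μ) : ℝ) : EReal)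
      ≤ (RandomWalk.asymptoticEntropy μ : EReal) ∧
    ((4 * (1 - RandomWalk.spectralRadius μ) : ℝ) : EReal)
      ≤ (RandomWalk.asymptoticEntropy μ : EReal) := by
  have hA : 0 ≤ RandomWalk.A (RandomWalk.drift μ / RandomWalk.M₂ μ).toReal :=
    RandomWalk.A_nonneg ⟨neg_one_lt_zero.trans_le ENNReal.toReal_nonneg,
      RandomWalk.toReal_drift_div_M₂_lt_one hsymm hM₂⟩
  have h_main := hsymm.A_add_le_asymptoticEntropy hM₂
  have h_mean := ne_top_of_le_ne_top hM₂ (RandomWalk.meanLength_le_M₂ μ)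
  exact ⟨fun x => RandomWalk.A_nonneg, RandomWalk.tendsto_entropy_convPow_div μ,
    RandomWalk.tendsto_meanLength_convPow_div h_mean, RandomWalk.drift_div_M₂_lt_one hsymm hM₂,
    RandomWalk.coe_le_coe_ennreal h_main,
    RandomWalk.coe_le_coe_ennreal fun h => (le_add_of_nonneg_left hA).trans (h_main h)⟩

theorem mainTheorem8 {Γ : Type*} [Group Γ] [Countable Γ] [MetricSpace Γ] [IsIsometricSMul Γ Γ]
    (hproper : ∀ r : ℝ, (Metric.closedBall (1 : Γ) r).Finite)
    (μ : PMF Γ) (hsymm : RandomWalk.IsSymmetric μ) (hM₂ : RandomWalk.M₂ μ ≠ ∞) :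
    -- nonnegativity of `A` on its domain
    (∀ x ∈ Set.Ioo (-1 : ℝ) 1, 0 ≤ RandomWalk.A x) ∧
    -- the limits defining `h` and `ℓ` exist, and `ℓ / M₂(μ)` lies in the domain of `A`
    Tendsto (fun n : ℕ => RandomWalk.entropy (RandomWalk.convPow μ n) / n) atTop
      (𝓝 (RandomWalk.asymptoticEntropy μ)) ∧
    Tendsto (fun n : ℕ => RandomWalk.meanLength (RandomWalk.convPow μ n) / n) atTop
      (𝓝 (RandomWalk.drift μ)) ∧
    RandomWalk.drift μ / RandomWalk.M₂ μ < 1 ∧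
    -- the inequality, and Ledrappier's inequality, which it strengthens
    ((RandomWalk.A (RandomWalk.drift μ / RandomWalk.M₂ μ).toReal
        + 4 * (1 - RandomWalk.spectralRadius μ) : ℝ) : EReal)
      ≤ (RandomWalk.asymptoticEntropy μ : EReal) ∧
    ((4 * (1 - RandomWalk.spectralRadius μ) : ℝ) : EReal)
      ≤ (RandomWalk.asymptoticEntropy μ : EReal) :=
  mainTheorem8_general μ hsymm hM₂
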